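/- Let $X,Y,Z$ be the Pauli matrices and $R_z(\chi)=\mathrm{diag}(e^{i\chi},e^{-i\chi})$. For $A,B\in U(2)$ let $G(A,B)$ be the two-qubit unitary acting as $A$ on the even subspace (ordered basis $|00\rangle,|11\rangle$) and as $B$ on the odd subspace (ordered basis $|01\rangle,|10\rangle$); these are the parity-preserving (P.P.) gates. A P.P. gate $U$ has nonlocal parameters $(a,b,c)\in\mathbb R^3$ if, for some real $\delta,\chi_1,\chi_2,\xi_1,\xi_2$, $$U=e^{i\delta}\,\bigl[R_z(\chi_1)\otimes R_z(\chi_2)\bigr]\;e^{i(a X\otimes X+b Y\otimes Y+c Z\otimes Z)}\;\bigl[R_z(\xi_1)\otimes R_z(\xi_2)\bigr].$$ Let $M_a$, $M_b$, $M_c$ be the sets of P.P. gates that have nonlocal parameters with $a=0$, $b=0$, $c=0$, respectively ($M_c$ is the set of matchgates, up to a global phase). Encode each of $n$ logical qubits in two neighbouring qubits of a line of $2n$ qubits by $|0\rangle_L=|00\rangle$, $|1\rangle_L=|11\rangle$, and let $E_n$ be the resulting isometry. A set $S$ of two-qubit gates is called universal if, using gates of $S$ on nearest-neighbour qubits of the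 line only: 1. for every $n$ and every unitary $U$ on $n$ qubits there is a finite circuit whose unitary $W$ satisfies $WE_n=z\,E_nU$ for some phase $z$; 2. there is a constant $C$, depending only on $S$, such that every circuit of $s$ arbitrary one- and two-qubit unitaries on $n$ qubits (acting on any qubits) is implemented in this same sense by a circuit of at most $C\,n\,s$ gates. Then: (i) $M_b$ is universal, and so is $M_a$; in fact $M_a=M_b$. (ii) For every gate $g$ with nonlocal parameters $(a,0,c)$ where $c\notin\frac{\pi}{2}\mathbb Z$ (that is, $c\neq 0$ when $c$ is normalized to $[0,\frac{\pi}{2})$), the set consisting of all $G(A,A)$ with $A\in U(2)$, all local $Z$-rotations $R_z(\chi_1)\otimes R_z(\chi_2)$, and $g$ is contained in $M_b$ and is already universal. (iii) In contrast, $M_c$ is not universal, even approximately and with no bound on the size of circuits: there are $n$, a unitary $U$ on $n$ qubits and $\varepsilon>0$ such that no nearest-neighbour circuit of gates of $M_c$ on $2n$ qubits has a unitary $W$ for which all entries of $WE_n-z\,E_nU$ are at most $\varepsilon$ in absolute value for some phase $z$. -/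

import Mathlib

open scoped Kronecker

namespace PPGates

noncomputable section

/-- The state space index of a register of `m` qubits: bit strings of length `m`. -/
abbrev Bits (m : ℕ) : Type := Fin m → Fin 2

/-- Operators on one qubit, in the basis `|0⟩, |1⟩`. -/
abbrev Op1 : Type := Matrix (Fin 2) (Fin 2) ℂ

/-- Operators on two qubits, in the basis `|p.1 p.2⟩`. -/
abbrev Op2 : Type := Matrix (Fin 2 × Fin 2) (Fin 2 × Fin 2) ℂ

/-- Operators on a register of `m` qubits, in the computational basis. -/
abbrev Op (m : ℕ) : Type := Matrix (Bits m) (Bits m) ℂ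

/-! ### Parity-preserving gates and their nonlocal parameters -/

/-- The operator `G(A,B)`: `A` acts on the even subspace with ordered basis `|00⟩, |11⟩`, and `B` on
the odd subspace with ordered basis `|01⟩, |10⟩`. -/
def ppGate (A B : Op1) : Op2 := fun p q =>
  if p.1 = p.2 then
    if q.1 = q.2 then A p.1 q.1 else 0
  else
    if q.1 = q.2 then 0 else B p.1 q.1

/-- Parity-preserving (P.P.) two-qubit gates: the unitaries `G(A,B)`. -/
def IsPP (U : Op2) : Prop :=
  ∃ A ∈ Matrix.unitaryGroup (Fin 2) ℂ, ∃ B ∈ Matrix.unitaryGroup (Fin 2) ℂ, U = ppGate A B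

def pauliX : Op1 := !![0, 1; 1, 0]

def pauliY : Op1 := !![0, -Complex.I; Complex.I, 0]

def pauliZ : Op1 := !![1, 0; 0, -1]

/-- The rotation `R_z(χ) = diag(e^{iχ}, e^{-iχ})`. -/
def rotZ (χ : ℝ) : Op1 :=
  !![Complex.exp (χ * Complex.I), 0; 0, Complex.exp (-(χ * Complex.I))]

/-- The nonlocal core `exp(i(a X⊗X + b Y⊗Y + c Z⊗Z))`. -/
def nonlocalCore (a b c : ℝ) : Op2 :=
  NormedSpace.exp (Complex.I •
    ((a : ℂ) • (pauliX ⊗ₖ pauliX) + (b : ℂ) • (pauliY ⊗ₖ pauliY) + (c : ℂ) • (pauliZ ⊗ₖ pauliZ)))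

/-- `U` has nonlocal parameters `(a, b, c)` as a P.P. gate: up to a global phase and local
`Z`-rotations on either side, it is the core `exp(i(a X⊗X + b Y⊗Y + c Z⊗Z))`. -/
def HasParams (U : Op2) (a b c : ℝ) : Prop :=
  ∃ δ χ₁ χ₂ ξ₁ ξ₂ : ℝ,
    U = Complex.exp (δ * Complex.I) •
      ((rotZ χ₁ ⊗ₖ rotZ χ₂) * nonlocalCore a b c * (rotZ ξ₁ ⊗ₖ rotZ ξ₂))

/-- P.P. gates with `a = 0`. -/
def Ma : Set Op2 := {U | IsPP U ∧ ∃ b c : ℝ, HasParams U 0 b c}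

/-- P.P. gates with `b = 0`. -/
def Mb : Set Op2 := {U | IsPP U ∧ ∃ a c : ℝ, HasParams U a 0 c}

/-- P.P. gates with `c = 0`, i.e. the matchgates. -/
def Mc : Set Op2 := {U | IsPP U ∧ ∃ a b : ℝ, HasParams U a b 0}

/-- The gates `G(A,A)` with `A` unitary, the local `Z`-rotations, and one further gate `g`. -/
def constructionSet (g : Op2) : Set Op2 :=
  {U | ∃ A ∈ Matrix.unitaryGroup (Fin 2) ℂ, U = ppGate A A} ∪
  {U | ∃ χ₁ χ₂ : ℝ, U = rotZ χ₁ ⊗ₖ rotZ χ₂} ∪ {g}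

/-! ### Circuits -/

/-- The one-qubit operator `A` acting on qubit `i` of a register of `m` qubits. -/
def onQubit {m : ℕ} (i : Fin m) (A : Op1) : Op m := fun y x =>
  if ∀ k, k ≠ i → y k = x k then A (y i) (x i) else 0

/-- The two-qubit operator `G` acting on the qubits `i` (first) and `j` (second) of a register of
`m` qubits; used for `i ≠ j` only. -/
def onPair {m : ℕ} (i j : Fin m) (G : Op2) : Op m := fun y x =>
  if ∀ k, k ≠ i → k ≠ j → y k = x k then G (y i, y j) (x i, x j) else 0

/-- The elementary steps of an unrestricted quantum circuit on `n` qubits: an arbitrary unitary on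
one qubit, or an arbitrary unitary on two distinct qubits at any distance. -/
def elementaryGates (n : ℕ) : Set (Op n) :=
  {M | ∃ i, ∃ A ∈ Matrix.unitaryGroup (Fin 2) ℂ, M = onQubit i A} ∪
  {M | ∃ i j, i ≠ j ∧ ∃ G ∈ Matrix.unitaryGroup (Fin 2 × Fin 2) ℂ, M = onPair i j G}

/-- The gates of `S` acting on nearest neighbours `k, k+1` of a line of `m` qubits. -/
def nearestNeighbourGates (S : Set Op2) (m : ℕ) : Set (Op m) :=
  {M | ∃ (k : ℕ) (hk : k + 1 < m), ∃ G ∈ S,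
    M = onPair (⟨k, Nat.lt_of_succ_lt hk⟩ : Fin m) ⟨k + 1, hk⟩ G}

/-- A circuit over a set of gates. The unitary it implements is `L.prod`, its size is `L.length`. -/
def IsCircuit {m : ℕ} (gates : Set (Op m)) (L : List (Op m)) : Prop := ∀ M ∈ L, M ∈ gates

/-! ### Encoded universality -/

/-- The encoding `|0⟩ ↦ |00⟩`, `|1⟩ ↦ |11⟩` of each of `n` logical qubits into two neighbouring
physical qubits, as an isometry from `n` to `2n` qubits. -/
def encode (n : ℕ) : Matrix (Bits (2 * n)) (Bits n) ℂ := fun y x =>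
  if ∀ i : Fin n, y ⟨2 * i, by omega⟩ = x i ∧ y ⟨2 * i + 1, by omega⟩ = x i then 1 else 0

/-- The physical operator `W` acts on encoded states as the logical operator `U`, up to a global
phase (in particular it preserves the code space). -/
def Implements {n : ℕ} (W : Op (2 * n)) (U : Op n) : Prop :=
  ∃ z : ℂ, ‖z‖ = 1 ∧ W * encode n = z • (encode n * U)

/-- As `Implements`, up to an error `ε` in each matrix entry. -/
def ApproxImplements {n : ℕ} (ε : ℝ) (W : Op (2 * n)) (U : Op n) : Prop :=
  ∃ z : ℂ, ‖z‖ = 1 ∧ ∀ y x, ‖(W * encode n) y x - z * (encode n * U) y x‖ ≤ ε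

/-- `S`, used on nearest neighbours only, is universal for quantum computation in the encoding:
every unitary on any number of logical qubits is implemented by some circuit, and every quantum
circuit is simulated efficiently, with a number of gates at most `C` times the number of logical
qubits times the size of the simulated circuit, where `C` depends on `S` only. -/
def Universal (S : Set Op2) : Prop :=
  (∀ (n : ℕ), ∀ U ∈ Matrix.unitaryGroup (Bits n) ℂ,
    ∃ L, IsCircuit (nearestNeighbourGates S (2 * n)) L ∧ Implements L.prod U) ∧
  (∃ C : ℕ, ∀ (n : ℕ) (K : List (Op n)), IsCircuit (elementaryGates n) K →
    ∃ L, IsCircuit (nearestNeighbourGates S (2 * n)) L ∧ Implements L.prod K.prod ∧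
      L.length ≤ C * n * K.length)

/-- The weak form of universality, with approximate implementation and no bound on circuit size. -/
def ApproxUniversal (S : Set Op2) : Prop :=
  ∀ (n : ℕ), ∀ U ∈ Matrix.unitaryGroup (Bits n) ℂ, ∀ ε : ℝ, 0 < ε →
    ∃ L, IsCircuit (nearestNeighbourGates S (2 * n)) L ∧ ApproxImplements ε L.prod U

end

end PPGates

namespace PPGates

noncomputable section

/-! On the even and odd subspaces X⊗X acts as X and X, Y⊗Y as -X and X, Z⊗Z as 1 and -1. So a P.P.
gate with parameters (a,b,c) has blocks e^{i(δ+c)} e^{i(a-b)X} and e^{i(δ-c)} e^{i(a+b)X}, up to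
Z-rotations that may be chosen independently in the two blocks (`nonlocalCore_eq`,
`hasParams_eq_ppGate`). Conjugation by Z flips the sign of X in one block, which exchanges the
conditions a = 0 and b = 0 (`Ma_eq_Mb`).

Universality. Inside an encoded pair, G(A,A) acts as the logical unitary A. If b = 0, both blocks of
g contain the same rotation e^{iaX}; a gate G(A,A) and Z-rotations remove it, leaving e^{icZ⊗Z} up
to a phase. This is diagonal, so across the boundary of two pairs it preserves the code space and
acts as the logical e^{icZ⊗Z} (`pairCost_zzGate`). With one-qubit gates it yields controlled
conjugates of R_z(2c). When sin 2c ≠ 0, products of such conjugates reach iX, giving a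
controlled-NOT (`pairCost_cnot`).

One-qubit unitaries and CNOTs generate all unitaries exactly, in a number of gates bounded for each
n (`exists_basic_unitary`): diagonal unitaries come from phases of parities, a vector is rotated to
a basis vector one qubit at a time, and a unitary is a product of complex reflections. For n = 2
this makes the cost of any two-qubit unitary on neighbours a constant; SWAPs bring distant qubits
together at linear cost (`universal_of_cost`).

Matchgates. If c = 0 the two blocks have equal determinant, and each nearest-neighbour gate on four
qubits rescales the quadratic form `quadForm`. The form vanishes at |0000⟩, hence on every state
reached from it, but not at the encoding of an entangled state cos|00⟩ + sin|11⟩; by continuity even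
approximation fails (`not_approxUniversal_Mc`). -/

/-! ### Algebra of local operators -/

/-- Overwrite the bits `i` and `j` of `y` by `p`. -/
def setPair {m : ℕ} (i j : Fin m) (y : Bits m) (p : Fin 2 × Fin 2) : Bits m :=
  Function.update (Function.update y i p.1) j p.2

lemma setPair_left {m : ℕ} {i j : Fin m} (h : i ≠ j) (y : Bits m) (p : Fin 2 × Fin 2) :
    setPair i j y p i = p.1 := by
  simp [setPair, h]

lemma setPair_right {m : ℕ} (i j : Fin m) (y : Bits m) (p : Fin 2 × Fin 2) :
    setPair i j y p j = p.2 := by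
  simp [setPair]

lemma setPair_of_ne {m : ℕ} {i j k : Fin m} (hi : k ≠ i) (hj : k ≠ j) (y : Bits m)
    (p : Fin 2 × Fin 2) : setPair i j y p k = y k := by
  simp [setPair, hi, hj]

lemma setPair_eq {m : ℕ} {i j : Fin m} {y z : Bits m}
    (h : ∀ k, k ≠ i → k ≠ j → y k = z k) : setPair i j y (z i, z j) = z := by
  funext k
  by_cases hj : k = j
  · subst hj; simp [setPair]
  by_cases hi : k = i
  · subst hi; simp [setPair, hj]
  · rw [setPair_of_ne hi hj, h k hi hj]

/-- Locality: only the four strings that differ from `y` on the two sites contribute. The product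
rule for gates and the matchgate computation both rest on this. -/
lemma sum_onPair {m : ℕ} {i j : Fin m} (h : i ≠ j) (G : Op2) (y : Bits m) (f : Bits m → ℂ) :
    ∑ z, onPair i j G y z * f z = ∑ p, G (y i, y j) p * f (setPair i j y p) := by
  symm
  refine Finset.sum_of_injOn (setPair i j y) ?_ (by simp) ?_ ?_
  · intro p _ q _ hpq
    refine Prod.ext ?_ ?_
    · rw [← setPair_left h y p, ← setPair_left h y q, hpq]
    · rw [← setPair_right i j y p, ← setPair_right i j y q, hpq]
  · intro z _ hz
    rw [onPair, if_neg, zero_mul]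
    intro hc
    exact hz ⟨(z i, z j), by simp, setPair_eq hc⟩
  · intro p _
    rw [onPair, if_pos, setPair_left h, setPair_right]
    intro k hi hj
    rw [setPair_of_ne hi hj]

lemma onPair_setPair {m : ℕ} {i j : Fin m} (h : i ≠ j) (G : Op2) (y x : Bits m)
    (p : Fin 2 × Fin 2) : onPair i j G (setPair i j y p) x =
      if ∀ k, k ≠ i → k ≠ j → y k = x k then G p (x i, x j) else 0 := by
  have : (∀ k, k ≠ i → k ≠ j → setPair i j y p k = x k) ↔
      ∀ k, k ≠ i → k ≠ j → y k = x k := by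
    refine forall_congr' fun k => forall_congr' fun hi => forall_congr' fun hj => ?_
    rw [setPair_of_ne hi hj]
  simp only [onPair, this, setPair_left h, setPair_right]

lemma onPair_mul {m : ℕ} {i j : Fin m} (h : i ≠ j) (G H : Op2) :
    onPair i j (G * H) = onPair i j G * onPair i j H := by
  ext y x
  rw [Matrix.mul_apply, sum_onPair h]
  simp only [onPair_setPair h]
  rw [onPair]
  split_ifs with hc
  · rw [Matrix.mul_apply]
  · simp

lemma onPair_diagonal {m : ℕ} (i j : Fin m) (d : Fin 2 × Fin 2 → ℂ) :
    onPair i j (Matrix.diagonal d) = Matrix.diagonal fun x => d (x i, x j) := by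
  ext y x
  rw [onPair, Matrix.diagonal_apply, Matrix.diagonal_apply]
  by_cases hyx : y = x
  · subst hyx; simp
  · rw [if_neg hyx]
    split_ifs with h1 h2
    · exfalso
      apply hyx
      rw [← setPair_eq h1, ← h2]
      exact (setPair_eq fun _ _ _ => rfl).symm
    · rfl
    · rfl

lemma onPair_one {m : ℕ} (i j : Fin m) : onPair i j (1 : Op2) = 1 := by
  rw [← Matrix.diagonal_one, onPair_diagonal, Matrix.diagonal_one]

lemma onPair_smul {m : ℕ} (i j : Fin m) (z : ℂ) (G : Op2) :
    onPair i j (z • G) = z • onPair i j G := by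
  ext y x
  simp only [onPair, Matrix.smul_apply, smul_eq_mul, mul_ite, mul_zero]

lemma star_onPair {m : ℕ} (i j : Fin m) (G : Op2) :
    star (onPair i j G) = onPair i j (star G) := by
  ext y x
  simp only [onPair, Matrix.star_apply, apply_ite star, star_zero]
  simp only [eq_comm]

lemma onPair_mem_unitaryGroup {m : ℕ} {i j : Fin m} (h : i ≠ j) {G : Op2}
    (hG : G ∈ Matrix.unitaryGroup (Fin 2 × Fin 2) ℂ) :
    onPair i j G ∈ Matrix.unitaryGroup (Bits m) ℂ := by
  rw [Matrix.mem_unitaryGroup_iff] at hG ⊢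
  rw [star_onPair, ← onPair_mul h, hG, onPair_one]

lemma sum_onQubit {m : ℕ} (i : Fin m) (A : Op1) (y : Bits m) (f : Bits m → ℂ) :
    ∑ z, onQubit i A y z * f z = ∑ p, A (y i) p * f (Function.update y i p) := by
  symm
  refine Finset.sum_of_injOn (Function.update y i) ?_ (by simp) ?_ ?_
  · exact (Function.update_injective y i).injOn
  · intro z _ hz
    rw [onQubit, if_neg, zero_mul]
    intro hc
    refine hz ⟨z i, by simp, ?_⟩
    funext k
    by_cases hk : k = i
    · subst hk; simp
    · simp [hk, hc k hk]
  · intro p _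
    rw [onQubit, if_pos, Function.update_self]
    intro k hk
    simp [hk]

lemma onQubit_mulVec {m : ℕ} (i : Fin m) (A : Op1) (v : Bits m → ℂ) (y : Bits m) :
    (onQubit i A).mulVec v y = A (y i) 0 * v (Function.update y i 0) +
      A (y i) 1 * v (Function.update y i 1) := by
  rw [Matrix.mulVec, dotProduct, sum_onQubit, Fin.sum_univ_two]

lemma onQubit_diagonal {m : ℕ} (i : Fin m) (d : Fin 2 → ℂ) :
    onQubit i (Matrix.diagonal d) = Matrix.diagonal fun x => d (x i) := by
  ext y x
  rw [onQubit, Matrix.diagonal_apply, Matrix.diagonal_apply]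
  by_cases hyx : y = x
  · subst hyx; simp
  · rw [if_neg hyx]
    split_ifs with h1 h2
    · exfalso
      apply hyx
      funext k
      by_cases hk : k = i
      · subst hk; exact h2
      · exact h1 k hk
    · rfl
    · rfl

lemma onQubit_one {m : ℕ} (i : Fin m) : onQubit i (1 : Op1) = 1 := by
  rw [← Matrix.diagonal_one, onQubit_diagonal, Matrix.diagonal_one]

lemma onQubit_mul {m : ℕ} (i : Fin m) (A B : Op1) :
    onQubit i (A * B) = onQubit i A * onQubit i B := by
  ext y x
  rw [Matrix.mul_apply, sum_onQubit]
  have (p : Fin 2) : (∀ k, k ≠ i → Function.update y i p k = x k) ↔ ∀ k, k ≠ i → y k = x k := by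
    refine forall_congr' fun k => forall_congr' fun hi => ?_
    rw [Function.update_of_ne hi]
  simp only [onQubit, this, Function.update_self]
  split_ifs with hc
  · rw [Matrix.mul_apply]
  · simp

lemma star_onQubit {m : ℕ} (i : Fin m) (A : Op1) :
    star (onQubit i A) = onQubit i (star A) := by
  ext y x
  simp only [onQubit, Matrix.star_apply, apply_ite star, star_zero]
  simp only [eq_comm]

lemma onQubit_mem_unitaryGroup {m : ℕ} (i : Fin m) {A : Op1}
    (hA : A ∈ Matrix.unitaryGroup (Fin 2) ℂ) :
    onQubit i A ∈ Matrix.unitaryGroup (Bits m) ℂ := by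
  rw [Matrix.mem_unitaryGroup_iff] at hA ⊢
  rw [star_onQubit, ← onQubit_mul, hA, onQubit_one]

lemma onPair_kronecker_one {m : ℕ} {i j : Fin m} (h : i ≠ j) (A : Op1) :
    onPair i j (A ⊗ₖ (1 : Op1)) = onQubit i A := by
  ext y x
  simp only [onPair, onQubit, Matrix.kroneckerMap_apply, Matrix.one_apply, mul_ite, mul_one,
    mul_zero]
  rw [← ite_and]
  refine if_congr ⟨fun ⟨h1, h2⟩ k hk => ?_, fun h1 => ⟨fun k hk _ => h1 k hk, h1 j h.symm⟩⟩ rfl rfl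
  by_cases hkj : k = j
  · rw [hkj, h2]
  · exact h1 k hk hkj

lemma onPair_one_kronecker {m : ℕ} {i j : Fin m} (h : i ≠ j) (A : Op1) :
    onPair i j ((1 : Op1) ⊗ₖ A) = onQubit j A := by
  ext y x
  simp only [onPair, onQubit, Matrix.kroneckerMap_apply, Matrix.one_apply, ite_mul, one_mul,
    zero_mul]
  rw [← ite_and]
  refine if_congr ⟨fun ⟨h1, h2⟩ k hk => ?_, fun h1 => ⟨fun k _ hk => h1 k hk, h1 i h⟩⟩ rfl rfl
  by_cases hki : k = i
  · rw [hki, h2]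
  · exact h1 k hki hk

/-! ### Controlled operators and basic gates -/

/-- The controlled operator acting on the second qubit as `A` if the first qubit is `|0⟩`, and as
`B` if it is `|1⟩`. -/
def ctrl (A B : Op1) : Op2 := fun p q =>
  if p.1 = q.1 then (if p.1 = 0 then A p.2 q.2 else B p.2 q.2) else 0

def cnot : Op2 := ctrl 1 pauliX

def hadamard : Op1 := ((√2 : ℝ) : ℂ)⁻¹ • !![1, 1; 1, -1]

lemma sqrt_two_inv_mul_self : ((√2 : ℝ) : ℂ)⁻¹ * ((√2 : ℝ) : ℂ)⁻¹ = 1 / 2 := by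
  rw [← mul_inv, ← Complex.ofReal_mul, Real.mul_self_sqrt (by norm_num)]
  norm_num

lemma hadamard_mul_self : hadamard * hadamard = 1 := by
  rw [hadamard, Matrix.smul_mul, Matrix.mul_smul, smul_smul, sqrt_two_inv_mul_self]
  ext i j
  fin_cases i <;> fin_cases j <;> norm_num [Matrix.mul_apply, Fin.sum_univ_two]

lemma star_hadamard : star hadamard = hadamard := by
  ext i j
  fin_cases i <;> fin_cases j <;> simp [hadamard, Matrix.star_apply]

lemma hadamard_mem : hadamard ∈ Matrix.unitaryGroup (Fin 2) ℂ := by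
  rw [Matrix.mem_unitaryGroup_iff, star_hadamard, hadamard_mul_self]

lemma pauliX_apply (p q : Fin 2) : pauliX p q = if p = q + 1 then 1 else 0 := by
  fin_cases p <;> fin_cases q <;> simp [pauliX]

lemma pauliX_mul_self : pauliX * pauliX = 1 := by
  ext i j
  fin_cases i <;> fin_cases j <;> simp [pauliX]

lemma star_pauliX : star pauliX = pauliX := by
  ext i j
  fin_cases i <;> fin_cases j <;> simp [pauliX, Matrix.star_apply]

lemma pauliX_mem : pauliX ∈ Matrix.unitaryGroup (Fin 2) ℂ := by
  rw [Matrix.mem_unitaryGroup_iff, star_pauliX, pauliX_mul_self]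

lemma ctrl_mul (A B A' B' : Op1) : ctrl A B * ctrl A' B' = ctrl (A * A') (B * B') := by
  ext ⟨p, q⟩ ⟨r, s⟩
  fin_cases p <;> fin_cases r <;>
    simp [ctrl, Matrix.mul_apply, Fintype.sum_prod_type, Fin.sum_univ_two]

lemma ctrl_one_one : ctrl 1 1 = 1 := by
  ext ⟨p, q⟩ ⟨r, s⟩
  fin_cases p <;> fin_cases r <;> simp [ctrl, Matrix.one_apply]

lemma star_ctrl (A B : Op1) : star (ctrl A B) = ctrl (star A) (star B) := by
  ext ⟨p, q⟩ ⟨r, s⟩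
  fin_cases p <;> fin_cases r <;> simp [ctrl, Matrix.star_apply]

lemma star_cnot : star cnot = cnot := by
  rw [cnot, star_ctrl, star_one, star_pauliX]

lemma cnot_mul_self : cnot * cnot = 1 := by
  rw [cnot, ctrl_mul, pauliX_mul_self, one_mul, ctrl_one_one]

lemma cnot_mem : cnot ∈ Matrix.unitaryGroup (Fin 2 × Fin 2) ℂ := by
  rw [Matrix.mem_unitaryGroup_iff, star_cnot, cnot_mul_self]

lemma cnot_apply (p q r s : Fin 2) :
    cnot (p, q) (r, s) = if p = r ∧ q = s + r then 1 else 0 := by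
  fin_cases p <;> fin_cases q <;> fin_cases r <;> fin_cases s <;> simp [cnot, ctrl, pauliX]

/-- One-qubit unitaries and `CNOT`s between any two qubits. -/
def basicGates (n : ℕ) : Set (Op n) :=
  {M | ∃ i, ∃ A ∈ Matrix.unitaryGroup (Fin 2) ℂ, M = onQubit i A} ∪
  {M | ∃ i j, i ≠ j ∧ M = onPair i j cnot}

lemma onQubit_mem_basicGates {n : ℕ} (i : Fin n) {A : Op1}
    (hA : A ∈ Matrix.unitaryGroup (Fin 2) ℂ) : onQubit i A ∈ basicGates n :=
  Or.inl ⟨i, A, hA, rfl⟩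

lemma cnot_mem_basicGates {n : ℕ} {i j : Fin n} (h : i ≠ j) :
    onPair i j cnot ∈ basicGates n :=
  Or.inr ⟨i, j, h, rfl⟩

lemma basicGates_subset_elementaryGates (n : ℕ) : basicGates n ⊆ elementaryGates n := by
  rintro M (h | ⟨i, j, hij, rfl⟩)
  · exact Or.inl h
  · exact Or.inr ⟨i, j, hij, cnot, cnot_mem, rfl⟩

lemma basicGates_unitary {n : ℕ} {M : Op n} (h : M ∈ basicGates n) :
    M ∈ Matrix.unitaryGroup (Bits n) ℂ := by
  rcases h with ⟨i, A, hA, rfl⟩ | ⟨i, j, hij, rfl⟩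
  · exact onQubit_mem_unitaryGroup i hA
  · exact onPair_mem_unitaryGroup hij cnot_mem

lemma star_mem_basicGates {n : ℕ} {M : Op n} (h : M ∈ basicGates n) : star M ∈ basicGates n := by
  rcases h with ⟨i, A, hA, rfl⟩ | ⟨i, j, hij, rfl⟩
  · rw [star_onQubit]
    exact onQubit_mem_basicGates i (Unitary.star_mem hA)
  · rw [star_onPair, star_cnot]
    exact cnot_mem_basicGates hij

/-! ### Products of a bounded number of basic gates -/

/-- `U` is a product of at most `k` basic gates. -/
def Basic {n : ℕ} (k : ℕ) (U : Op n) : Prop :=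
  ∃ L, IsCircuit (basicGates n) L ∧ L.prod = U ∧ L.length ≤ k

lemma Basic.one {n : ℕ} : Basic 0 (1 : Op n) :=
  ⟨[], by simp [IsCircuit], rfl, le_rfl⟩

lemma Basic.of_mem {n : ℕ} {U : Op n} (h : U ∈ basicGates n) : Basic 1 U :=
  ⟨[U], by simpa [IsCircuit] using h, by simp, le_rfl⟩

lemma Basic.mul {n k l : ℕ} {U V : Op n} (hU : Basic k U) (hV : Basic l V) :
    Basic (k + l) (U * V) := by
  obtain ⟨K, hK, rfl, hk⟩ := hU
  obtain ⟨L, hL, rfl, hl⟩ := hV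
  refine ⟨K ++ L, fun M hM => ?_, List.prod_append, ?_⟩
  · rcases List.mem_append.1 hM with h | h
    exacts [hK M h, hL M h]
  · rw [List.length_append]
    exact add_le_add hk hl

lemma Basic.mono {n k l : ℕ} {U : Op n} (hU : Basic k U) (h : k ≤ l) : Basic l U := by
  obtain ⟨K, hK, hp, hk⟩ := hU
  exact ⟨K, hK, hp, hk.trans h⟩

lemma Basic.star {n k : ℕ} {U : Op n} (hU : Basic k U) : Basic k (star U) := by
  obtain ⟨K, hK, rfl, hk⟩ := hU
  induction K generalizing k with
  | nil => simpa using Basic.one.mono (Nat.zero_le _)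
  | cons M K ih =>
    have h1 := ih (fun M hM => hK M (List.mem_cons_of_mem _ hM)) le_rfl
    have h2 := h1.mul (Basic.of_mem (star_mem_basicGates (hK M List.mem_cons_self)))
    rw [List.prod_cons, star_mul]
    exact h2.mono hk

lemma Basic.unitary {n k : ℕ} {U : Op n} (hU : Basic k U) :
    U ∈ Matrix.unitaryGroup (Bits n) ℂ := by
  obtain ⟨K, hK, rfl, -⟩ := hU
  exact Submonoid.list_prod_mem _ fun M hM => basicGates_unitary (hK M hM)

/-! ### Diagonal unitaries -/

/-- The diagonal unitary `|x⟩ ↦ e^{i f(x)} |x⟩`. -/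
def phaseDiag {n : ℕ} (f : Bits n → ℝ) : Op n :=
  Matrix.diagonal fun x => Complex.exp (f x * Complex.I)

lemma phaseDiag_add {n : ℕ} (f g : Bits n → ℝ) :
    phaseDiag (f + g) = phaseDiag f * phaseDiag g := by
  rw [phaseDiag, phaseDiag, phaseDiag, Matrix.diagonal_mul_diagonal]
  congr 1
  funext x
  rw [← Complex.exp_add]
  simp [add_mul]

lemma phaseDiag_zero {n : ℕ} : phaseDiag (0 : Bits n → ℝ) = 1 := by
  simp [phaseDiag]

lemma phaseDiag_mulVec {n : ℕ} (f : Bits n → ℝ) (v : Bits n → ℂ) (x : Bits n) :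
    (phaseDiag f).mulVec v x = Complex.exp (f x * Complex.I) * v x := by
  rw [phaseDiag, Matrix.mulVec_diagonal]

/-- The operator `|x⟩ ↦ |σ x⟩`. -/
def mapOp {n : ℕ} (σ : Bits n → Bits n) : Op n := fun y x => if y = σ x then 1 else 0

lemma mapOp_conj_diagonal {n : ℕ} {σ : Bits n → Bits n} (h : Function.Involutive σ)
    (d : Bits n → ℂ) :
    mapOp σ * Matrix.diagonal d * mapOp σ = Matrix.diagonal fun x => d (σ x) := by
  ext y x
  rw [Matrix.mul_apply]
  simp only [Matrix.mul_diagonal]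
  rw [Finset.sum_eq_single (σ x)]
  · by_cases hyx : y = x
    · subst hyx
      simp [mapOp, h y]
    · simp [mapOp, h x, hyx]
  · intro z _ hz
    simp [mapOp, hz]
  · simp

lemma onPair_cnot {n : ℕ} {a b : Fin n} (h : a ≠ b) :
    onPair a b cnot = mapOp fun x => Function.update x b (x b + x a) := by
  ext y x
  rw [onPair, cnot_apply, ← ite_and, mapOp]
  refine if_congr ⟨fun ⟨h1, h2, h3⟩ => ?_, ?_⟩ rfl rfl
  · funext k
    by_cases hb : k = b
    · subst hb; simp [h3]
    by_cases ha : k = a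
    · subst ha; simp [h, h2]
    · simp [hb, h1 k ha hb]
  · rintro rfl
    exact ⟨fun k _ hb => by simp [hb], by simp [h], by simp⟩

lemma onQubit_pauliX {n : ℕ} (b : Fin n) :
    onQubit b pauliX = mapOp fun x => Function.update x b (x b + 1) := by
  ext y x
  rw [onQubit, pauliX_apply, ← ite_and, mapOp]
  refine if_congr ⟨fun ⟨h1, h2⟩ => ?_, ?_⟩ rfl rfl
  · funext k
    by_cases hb : k = b
    · subst hb; simp [h2]
    · simp [hb, h1 k hb]
  · rintro rfl
    exact ⟨fun k hb => by simp [hb], by simp⟩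

lemma fin_two_add_add_self (s t : Fin 2) : s + t + t = s := by
  revert s t; decide

/-- All the diagonal unitaries `e^{iθf}` are products of a bounded number of basic gates. -/
def PhaseGen {n : ℕ} (f : Bits n → ℝ) : Prop := ∃ k, ∀ θ : ℝ, Basic k (phaseDiag (θ • f))

lemma PhaseGen.add {n : ℕ} {f g : Bits n → ℝ} (hf : PhaseGen f) (hg : PhaseGen g) :
    PhaseGen (f + g) := by
  obtain ⟨k, hk⟩ := hf
  obtain ⟨l, hl⟩ := hg
  refine ⟨k + l, fun θ => ?_⟩
  rw [smul_add, phaseDiag_add]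
  exact (hk θ).mul (hl θ)

lemma PhaseGen.smul {n : ℕ} {f : Bits n → ℝ} (hf : PhaseGen f) (c : ℝ) : PhaseGen (c • f) := by
  obtain ⟨k, hk⟩ := hf
  refine ⟨k, fun θ => ?_⟩
  rw [smul_smul]
  exact hk _

lemma PhaseGen.comp {n : ℕ} {f : Bits n → ℝ} (hf : PhaseGen f) {σ : Bits n → Bits n}
    (hσ : Function.Involutive σ) (hm : mapOp σ ∈ basicGates n) : PhaseGen (f ∘ σ) := by
  obtain ⟨k, hk⟩ := hf
  refine ⟨1 + k + 1, fun θ => ?_⟩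
  have h : phaseDiag (θ • (f ∘ σ)) = mapOp σ * phaseDiag (θ • f) * mapOp σ := by
    rw [phaseDiag, phaseDiag, mapOp_conj_diagonal hσ]
    rfl
  rw [h]
  exact ((Basic.of_mem hm).mul (hk θ)).mul (Basic.of_mem hm)

lemma PhaseGen.comp_cnot {n : ℕ} {f : Bits n → ℝ} (hf : PhaseGen f) {a b : Fin n} (h : a ≠ b) :
    PhaseGen fun x => f (Function.update x b (x b + x a)) := by
  refine hf.comp (σ := fun x => Function.update x b (x b + x a)) (fun x => ?_) ?_
  · simp [h, fin_two_add_add_self]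
  · rw [← onPair_cnot h]
    exact cnot_mem_basicGates h

lemma PhaseGen.comp_not {n : ℕ} {f : Bits n → ℝ} (hf : PhaseGen f) (b : Fin n) :
    PhaseGen fun x => f (Function.update x b (x b + 1)) := by
  refine hf.comp (σ := fun x => Function.update x b (x b + 1)) (fun x => ?_) ?_
  · simp [fin_two_add_add_self]
  · rw [← onQubit_pauliX]
    exact onQubit_mem_basicGates b pauliX_mem

/-- The indicator function of the bit strings that agree with `t` on `S`. -/
def agree {n : ℕ} (t : Bits n) (S : Finset (Fin n)) (x : Bits n) : ℝ :=
  if ∀ k ∈ S, x k = t k then 1 else 0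

lemma agree_insert {n : ℕ} (t : Bits n) (S : Finset (Fin n)) (a : Fin n) (x : Bits n) :
    agree t (insert a S) x = if x a = t a then agree t S x else 0 := by
  simp only [agree, Finset.forall_mem_insert, ite_and]

lemma agree_update {n : ℕ} (t : Bits n) {S : Finset (Fin n)} {a : Fin n} (ha : a ∉ S) (x : Bits n)
    (s : Fin 2) : agree t S (Function.update x a s) = agree t S x := by
  have : (∀ k ∈ S, Function.update x a s k = t k) ↔ ∀ k ∈ S, x k = t k := by
    refine forall_congr' fun k => forall_congr' fun hk => ?_
    rw [Function.update_of_ne (ne_of_mem_of_not_mem hk ha)]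
  simp only [agree, this]

lemma exp_mem_unitary (θ : ℝ) :
    star (Complex.exp (θ * Complex.I)) * Complex.exp (θ * Complex.I) = 1 := by
  rw [Complex.star_def, Complex.conj_mul', Complex.norm_exp_ofReal_mul_I]
  norm_num

lemma diagonal_exp_mem {ι : Type*} [Fintype ι] [DecidableEq ι] (f : ι → ℝ) :
    Matrix.diagonal (fun x => Complex.exp (f x * Complex.I)) ∈ Matrix.unitaryGroup ι ℂ := by
  rw [Matrix.mem_unitaryGroup_iff', Matrix.star_eq_conjTranspose, Matrix.diagonal_conjTranspose,
    Matrix.diagonal_mul_diagonal, ← Matrix.diagonal_one]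
  congr 1
  funext x
  exact exp_mem_unitary _

lemma phaseGen_qubit {n : ℕ} (a : Fin n) (f : Fin 2 → ℝ) : PhaseGen fun x => f (x a) := by
  refine ⟨1, fun θ => Basic.of_mem ?_⟩
  have := onQubit_diagonal a fun p => Complex.exp ((θ * f p : ℝ) * Complex.I)
  have h2 := onQubit_mem_basicGates a (diagonal_exp_mem fun p => θ * f p)
  rwa [this] at h2

/-- The identity 1[p]·1[q] = (1[p] + 1[q] - 1[p xor q]) / 2 trades a condition on one more qubit for
a parity, and a parity is made by conjugating with a CNOT. The set has the form `insert a S` so that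
it is never empty and the base case is a one-qubit gate. -/
lemma phaseGen_agree_insert {n : ℕ} (t : Bits n) (S : Finset (Fin n)) :
    ∀ a ∉ S, PhaseGen (agree t (insert a S)) := by
  induction S using Finset.induction_on with
  | empty =>
    intro a _
    convert phaseGen_qubit a fun p => if p = t a then 1 else 0 using 2 with x
    simp [agree]
  | insert b S hb ih =>
    intro a ha
    rw [Finset.mem_insert, not_or] at ha
    have hA := ih a ha.2
    have hB := ih b hb
    -- The xor term: the updated bit equals `t b` exactly when one, and only one, of `x a = t a` and
    -- `x b = t b` holds. The CNOT adds `x a`; a NOT is needed as well when `t a = 0`.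
    have hC : PhaseGen fun x =>
        agree t (insert b S) (Function.update x b (x b + x a + t a + 1)) := by
      rcases Fin.exists_fin_two.1 ⟨t a, rfl⟩ with h | h
      · convert (hB.comp_not b).comp_cnot ha.1 using 3 with x
        simp [h]
      · convert hB.comp_cnot ha.1 using 2 with x
        simp [h, fin_two_add_add_self]
    convert ((hA.add hB).add (hC.smul (-1))).smul (1 / 2) using 1
    funext x
    simp only [Pi.smul_apply, Pi.add_apply, agree_insert, agree_update t hb, Function.update_self,
      smul_eq_mul]
    generalize agree t S x = r
    generalize x a = p, x b = q, t a = p', t b = q'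
    fin_cases p <;> fin_cases q <;> fin_cases p' <;> fin_cases q' <;> simp <;> ring

/-- Every diagonal unitary is a product of a bounded number of basic gates. -/
lemma exists_basic_phaseDiag {n : ℕ} (hn : 0 < n) :
    ∃ k, ∀ f : Bits n → ℝ, Basic k (phaseDiag f) := by
  have hδ (t : Bits n) : PhaseGen (agree t Finset.univ) := by
    have := phaseGen_agree_insert t (Finset.univ.erase ⟨0, hn⟩) ⟨0, hn⟩ (by simp)
    rwa [Finset.insert_erase (Finset.mem_univ _)] at this
  have key (T : Finset (Bits n)) : ∃ k, ∀ f : Bits n → ℝ,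
      Basic k (phaseDiag (∑ t ∈ T, f t • agree t Finset.univ)) := by
    induction T using Finset.induction_on with
    | empty => exact ⟨0, fun f => by simpa [phaseDiag_zero] using Basic.one⟩
    | insert t T ht ih =>
      obtain ⟨k, hk⟩ := ih
      obtain ⟨l, hl⟩ := hδ t
      refine ⟨l + k, fun f => ?_⟩
      rw [Finset.sum_insert ht, phaseDiag_add]
      exact (hl _).mul (hk f)
  obtain ⟨k, hk⟩ := key Finset.univ
  refine ⟨k, fun f => ?_⟩
  convert hk f using 2
  funext x
  rw [Finset.sum_apply, Finset.sum_eq_single x]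
  · simp [agree]
  · intro t _ ht
    have : ¬ ∀ k, x k = t k := fun h => ht (funext h).symm
    simp [agree, this]
  · simp

/-! ### Bounded generation of the unitary group by basic gates -/

lemma exp_neg_arg_mul (z : ℂ) : Complex.exp (-(z.arg : ℂ) * Complex.I) * z = ‖z‖ := by
  nth_rewrite 2 [← Complex.norm_mul_exp_arg_mul_I z]
  rw [mul_left_comm, ← Complex.exp_add]
  ring_nf
  simp

/-- The components with bit `i` set can be removed from any vector by a bounded number of basic
gates that only mix strings differing in bit `i`. -/
lemma exists_basic_kill {n : ℕ} (hn : 0 < n) (i : Fin n) :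
    ∃ k, ∀ v : Bits n → ℂ, ∃ g : Op n, Basic k g ∧ (∀ x, x i = 1 → g.mulVec v x = 0) ∧
      ∀ x, v (Function.update x i 0) = 0 → v (Function.update x i 1) = 0 → g.mulVec v x = 0 := by
  obtain ⟨k, hk⟩ := exists_basic_phaseDiag hn
  refine ⟨1 + k + 1 + k, fun v => ?_⟩
  -- A Givens rotation done in parallel for all settings of the other bits. The phases `f'` turn
  -- each pair of amplitudes into (|v₀|, -i|v₁|); then H · `phaseDiag f` · H is e^{itX} on qubit
  -- `i`, with `t` independent of bit `i`, and its lower output i(sin t |v₀| - cos t |v₁|) vanishes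
  -- for t = arg(|v₀| + i|v₁|).
  set t : Bits n → ℝ := fun x => Complex.arg ((‖v (Function.update x i 0)‖ : ℂ) +
    (‖v (Function.update x i 1)‖ : ℂ) * Complex.I) with ht
  set f : Bits n → ℝ := fun x => if x i = 0 then t x else -t x with hf
  set f' : Bits n → ℝ := fun x =>
    -Complex.arg (v x) + if x i = 0 then 0 else -(Real.pi / 2) with hf'
  have hH := Basic.of_mem (onQubit_mem_basicGates i hadamard_mem)
  refine ⟨onQubit i hadamard * phaseDiag f * onQubit i hadamard * phaseDiag f',
    ((hH.mul (hk f)).mul hH).mul (hk f'), fun x hx => ?_, fun x h0 h1 => ?_⟩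
  · have ht0 : t (Function.update x i 0) = t x := by simp [ht]
    have ht1 : t (Function.update x i 1) = t x := by simp [ht]
    have hw0 : Complex.exp (f' (Function.update x i 0) * Complex.I) * v (Function.update x i 0) =
        ‖v (Function.update x i 0)‖ := by
      rw [← exp_neg_arg_mul]
      simp [hf']
    have hw1 : Complex.exp (f' (Function.update x i 1) * Complex.I) * v (Function.update x i 1) =
        -Complex.I * ‖v (Function.update x i 1)‖ := by
      rw [← exp_neg_arg_mul, ← mul_assoc, hf']
      have : Complex.exp (-(Real.pi / 2) * Complex.I) = -Complex.I := by
        rw [neg_mul, Complex.exp_neg, Complex.exp_pi_div_two_mul_I, Complex.inv_I]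
      rw [← this, ← Complex.exp_add]
      congr 2
      simp
      ring
    have hc := Complex.norm_mul_cos_arg ((‖v (Function.update x i 0)‖ : ℂ) +
      (‖v (Function.update x i 1)‖ : ℂ) * Complex.I)
    have hs := Complex.norm_mul_sin_arg ((‖v (Function.update x i 0)‖ : ℂ) +
      (‖v (Function.update x i 1)‖ : ℂ) * Complex.I)
    have hcs : Real.sin (t x) * ‖v (Function.update x i 0)‖ =
        Real.cos (t x) * ‖v (Function.update x i 1)‖ := by
      simp only [Complex.add_re, Complex.add_im, Complex.mul_re, Complex.mul_im, Complex.ofReal_re,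
        Complex.ofReal_im, Complex.I_re, Complex.I_im, mul_zero, mul_one, sub_zero,
        add_zero, zero_add] at hc hs
      simp only [ht]
      linear_combination Real.cos (t x) * hs - Real.sin (t x) * hc
    have hcs' : Complex.sin (t x) * ‖v (Function.update x i 0)‖ =
        Complex.cos (t x) * ‖v (Function.update x i 1)‖ := by
      exact_mod_cast congrArg Complex.ofReal hcs
    simp only [← Matrix.mulVec_mulVec, onQubit_mulVec, phaseDiag_mulVec, Function.update_idem,
      Function.update_self, hw0, hw1, hx]
    simp only [hf, Function.update_self, ht0, ht1, if_true, one_ne_zero, if_false,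
      Complex.exp_mul_I, Complex.ofReal_neg, Complex.cos_neg, Complex.sin_neg]
    simp [hadamard]
    linear_combination (2 * ((√2 : ℝ) : ℂ)⁻¹ ^ 2 * Complex.I) * hcs'
  · simp only [← Matrix.mulVec_mulVec, onQubit_mulVec, phaseDiag_mulVec, Function.update_idem,
      h0, h1]
    simp

lemma fin_two_eq_one {a : Fin 2} (h : a ≠ 0) : a = 1 := by
  revert a; decide

/-- A bounded number of basic gates maps any vector to a multiple of `|0…0⟩`. -/
lemma exists_basic_to_zero {n : ℕ} (hn : 0 < n) :
    ∃ k, ∀ v : Bits n → ℂ, ∃ g : Op n, Basic k g ∧ ∀ x, x ≠ 0 → g.mulVec v x = 0 := by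
  have key (S : Finset (Fin n)) : ∃ k, ∀ v : Bits n → ℂ, ∃ g : Op n, Basic k g ∧
      ∀ x : Bits n, (∃ j ∈ S, x j = 1) → g.mulVec v x = 0 := by
    induction S using Finset.induction_on with
    | empty => exact ⟨0, fun v => ⟨1, Basic.one, by simp⟩⟩
    | insert i S hi ih =>
      obtain ⟨k, hk⟩ := ih
      obtain ⟨l, hl⟩ := exists_basic_kill hn i
      refine ⟨l + k, fun v => ?_⟩
      obtain ⟨g, hg, hg0⟩ := hk v
      obtain ⟨g', hg', h1, h2⟩ := hl (g.mulVec v)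
      refine ⟨g' * g, hg'.mul hg, fun x hx => ?_⟩
      rw [← Matrix.mulVec_mulVec]
      by_cases hxi : x i = 1
      · exact h1 x hxi
      · obtain ⟨j, hj, hxj⟩ := hx
        have hji : j ≠ i := by rintro rfl; exact hxi hxj
        have hjS : j ∈ S := (Finset.mem_insert.1 hj).resolve_left hji
        exact h2 x (hg0 _ ⟨j, hjS, by simp [hji, hxj]⟩) (hg0 _ ⟨j, hjS, by simp [hji, hxj]⟩)
  obtain ⟨k, hk⟩ := key Finset.univ
  refine ⟨k, fun v => ?_⟩
  obtain ⟨g, hg, hg0⟩ := hk v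
  refine ⟨g, hg, fun x hx => hg0 x ?_⟩
  obtain ⟨j, hj⟩ := Function.ne_iff.1 hx
  exact ⟨j, Finset.mem_univ j, fin_two_eq_one hj⟩

lemma unitary_dotProduct {ι : Type*} [Fintype ι] [DecidableEq ι] {g : Matrix ι ι ℂ}
    (hg : g ∈ Matrix.unitaryGroup ι ℂ) (u v : ι → ℂ) :
    star (g.mulVec u) ⬝ᵥ g.mulVec v = star u ⬝ᵥ v := by
  rw [Matrix.star_mulVec, Matrix.dotProduct_mulVec, Matrix.vecMul_vecMul,
    ← Matrix.star_eq_conjTranspose, Matrix.mem_unitaryGroup_iff'.1 hg, Matrix.vecMul_one]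

lemma exists_phase_mul {p q : ℂ} (h : star p * p = star q * q) :
    ∃ θ : ℝ, Complex.exp (θ * Complex.I) * p = q := by
  have hn : ‖p‖ = ‖q‖ := by
    rw [Complex.star_def, Complex.conj_mul', Complex.conj_mul'] at h
    have h' : ‖p‖ ^ 2 = ‖q‖ ^ 2 := by exact_mod_cast h
    exact (sq_eq_sq₀ (norm_nonneg _) (norm_nonneg _)).1 h'
  refine ⟨q.arg + -p.arg, ?_⟩
  rw [Complex.ofReal_add, add_mul, Complex.exp_add, mul_assoc, Complex.ofReal_neg, exp_neg_arg_mul,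
    hn, mul_comm, Complex.norm_mul_exp_arg_mul_I]

/-- A complex reflection taking `u` to `v`, made of a bounded number of basic gates. -/
lemma exists_basic_reflection {n : ℕ} (hn : 0 < n) :
    ∃ k, ∀ u v : Bits n → ℂ, star u ⬝ᵥ u = star v ⬝ᵥ v → ∃ R : Op n, Basic k R ∧
      R.mulVec u = v ∧ ∀ z, star (u - v) ⬝ᵥ z = 0 → R.mulVec z = z := by
  obtain ⟨k, hk⟩ := exists_basic_to_zero hn
  obtain ⟨l, hl⟩ := exists_basic_phaseDiag hn
  refine ⟨k + l + k, fun u v huv => ?_⟩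
  by_cases hne : u = v
  · exact ⟨1, Basic.one.mono (Nat.zero_le _), by simp [hne], by simp⟩
  -- As `g` sends u - v to the line of |0…0⟩, the vectors gu and gv differ only at 0, and equal
  -- norms make those entries equal in modulus. One phase at |0…0⟩, conjugated by `g`, is the
  -- reflection.
  obtain ⟨g, hg, hg0⟩ := hk (u - v)
  have hgu := hg.unitary
  have hsub (x : Bits n) : g.mulVec (u - v) x = g.mulVec u x - g.mulVec v x := by
    rw [Matrix.mulVec_sub, Pi.sub_apply]
  have heq (x : Bits n) (hx : x ≠ 0) : g.mulVec u x = g.mulVec v x := by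
    rw [← sub_eq_zero, ← hsub, hg0 x hx]
  have hpq : star (g.mulVec u 0) * g.mulVec u 0 = star (g.mulVec v 0) * g.mulVec v 0 := by
    have h := huv
    rw [← unitary_dotProduct hgu u u, ← unitary_dotProduct hgu v v, dotProduct, dotProduct,
      ← Finset.add_sum_erase _ _ (Finset.mem_univ (0 : Bits n)),
      ← Finset.add_sum_erase _ _ (Finset.mem_univ (0 : Bits n)),
      Finset.sum_congr rfl (g := fun x => star (g.mulVec v) x * g.mulVec v x)] at h
    · exact add_right_cancel h
    · intro x hx
      rw [Pi.star_apply, Pi.star_apply, heq x (Finset.ne_of_mem_erase hx)]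
  obtain ⟨θ, hθ⟩ := exists_phase_mul hpq
  set f : Bits n → ℝ := fun x => if x = 0 then θ else 0 with hf
  have hgg : star g * g = 1 := Matrix.mem_unitaryGroup_iff'.1 hgu
  refine ⟨star g * phaseDiag f * g, (hg.star.mul (hl f)).mul hg, ?_, fun z hz => ?_⟩
  · have : (phaseDiag f).mulVec (g.mulVec u) = g.mulVec v := by
      funext x
      rw [phaseDiag_mulVec]
      by_cases hx : x = 0
      · subst hx; simpa [hf] using hθ
      · simpa [hf, hx] using heq x hx
    rw [← Matrix.mulVec_mulVec, ← Matrix.mulVec_mulVec, this, Matrix.mulVec_mulVec, hgg,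
      Matrix.one_mulVec]
  · have hz0 : g.mulVec z 0 = 0 := by
      rw [← unitary_dotProduct hgu, dotProduct, Finset.sum_eq_single 0] at hz
      · rcases mul_eq_zero.1 hz with h | h
        · exfalso
          rw [Pi.star_apply, star_eq_zero] at h
          have h0 : g.mulVec (u - v) = 0 := by
            funext x
            by_cases hx : x = 0
            · rw [hx, h]; rfl
            · exact hg0 x hx
          apply hne
          rw [← sub_eq_zero, ← Matrix.one_mulVec (u - v), ← hgg, ← Matrix.mulVec_mulVec, h0,
            Matrix.mulVec_zero]
        · exact h
      · intro x _ hx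
        rw [Pi.star_apply, hg0 x hx, star_zero, zero_mul]
      · simp
    have : (phaseDiag f).mulVec (g.mulVec z) = g.mulVec z := by
      funext x
      rw [phaseDiag_mulVec]
      by_cases hx : x = 0
      · subst hx; simp [hz0]
      · simp [hf, hx]
    rw [← Matrix.mulVec_mulVec, ← Matrix.mulVec_mulVec, this, Matrix.mulVec_mulVec, hgg,
      Matrix.one_mulVec]

/-- Every unitary on `n` qubits is a product of a bounded number of basic gates. -/
theorem exists_basic_unitary {n : ℕ} (hn : 0 < n) :
    ∃ k, ∀ U ∈ Matrix.unitaryGroup (Bits n) ℂ, Basic k U := by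
  obtain ⟨l, hl⟩ := exists_basic_reflection hn
  have key (T : Finset (Bits n)) : ∃ k, ∀ U ∈ Matrix.unitaryGroup (Bits n) ℂ, ∃ R : Op n,
      Basic k R ∧ ∀ x ∈ T, (R * U).mulVec (Pi.single x 1) = Pi.single x 1 := by
    induction T using Finset.induction_on with
    | empty => exact ⟨0, fun U _ => ⟨1, Basic.one, by simp⟩⟩
    | insert y T hy ih =>
      obtain ⟨k, hk⟩ := ih
      refine ⟨l + k, fun U hU => ?_⟩
      obtain ⟨R, hR, hT⟩ := hk U hU
      have hRU : R * U ∈ Matrix.unitaryGroup (Bits n) ℂ := mul_mem hR.unitary hU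
      obtain ⟨R', hR', h1, h2⟩ := hl ((R * U).mulVec (Pi.single y 1)) (Pi.single y 1)
        (unitary_dotProduct hRU _ _)
      refine ⟨R' * R, hR'.mul hR, fun x hx => ?_⟩
      rw [mul_assoc, ← Matrix.mulVec_mulVec]
      rcases Finset.mem_insert.1 hx with rfl | hx
      · exact h1
      · rw [hT x hx]
        -- The next reflection does not disturb a basis vector e_x already fixed: RU is unitary and
        -- fixes e_x, so ⟨RU e_y, e_x⟩ = ⟨e_y, e_x⟩ and RU e_y - e_y is orthogonal to e_x.
        apply h2
        rw [star_sub, sub_dotProduct]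
        nth_rewrite 1 [← hT x hx]
        rw [unitary_dotProduct hRU, sub_self]
  obtain ⟨k, hk⟩ := key Finset.univ
  refine ⟨k, fun U hU => ?_⟩
  obtain ⟨R, hR, hT⟩ := hk U hU
  have h1 : R * U = 1 := by
    refine Matrix.ext_of_mulVec_single fun x => ?_
    rw [hT x (Finset.mem_univ x), Matrix.one_mulVec]
  have h2 : U = star R := by
    rw [← one_mul U, ← Matrix.mem_unitaryGroup_iff'.1 hR.unitary, mul_assoc, h1, mul_one]
  rw [h2]
  exact hR.star

/-! ### Parity-preserving gates -/

lemma ppGate_mul (A B A' B' : Op1) : ppGate A B * ppGate A' B' = ppGate (A * A') (B * B') := by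
  ext ⟨p, q⟩ ⟨r, s⟩
  fin_cases p <;> fin_cases q <;> fin_cases r <;> fin_cases s <;>
    simp [ppGate, Matrix.mul_apply, Fintype.sum_prod_type, Fin.sum_univ_two, add_comm]

lemma ppGate_one : ppGate 1 1 = 1 := by
  ext ⟨p, q⟩ ⟨r, s⟩
  fin_cases p <;> fin_cases q <;> fin_cases r <;> fin_cases s <;> simp [ppGate]

lemma star_ppGate (A B : Op1) : star (ppGate A B) = ppGate (star A) (star B) := by
  ext ⟨p, q⟩ ⟨r, s⟩
  fin_cases p <;> fin_cases q <;> fin_cases r <;> fin_cases s <;> simp [ppGate, Matrix.star_apply]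

lemma ppGate_smul (z : ℂ) (A B : Op1) : ppGate (z • A) (z • B) = z • ppGate A B := by
  ext ⟨p, q⟩ ⟨r, s⟩
  simp only [ppGate, Matrix.smul_apply, smul_eq_mul]
  split_ifs <;> simp

/-- The rotation `e^{iθX}`. -/
def rotX (θ : ℝ) : Op1 :=
  !![Complex.cos θ, Complex.I * Complex.sin θ; Complex.I * Complex.sin θ, Complex.cos θ]

lemma rotZ_eq_diagonal (χ : ℝ) :
    rotZ χ = Matrix.diagonal ![Complex.exp (χ * Complex.I), Complex.exp (-(χ * Complex.I))] := by
  ext i j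
  fin_cases i <;> fin_cases j <;> simp [rotZ]

lemma hadamard_conj_diagonal (x y : ℂ) : hadamard * Matrix.diagonal ![x, y] * hadamard =
    !![(x + y) / 2, (x - y) / 2; (x - y) / 2, (x + y) / 2] := by
  rw [hadamard, Matrix.smul_mul, Matrix.smul_mul, Matrix.mul_smul, smul_smul,
    sqrt_two_inv_mul_self]
  ext i j
  fin_cases i <;> fin_cases j <;>
    simp [-Matrix.cons_mul, Matrix.mul_apply, Fin.sum_univ_two, Matrix.diagonal_apply] <;> ring

lemma rotX_eq (θ : ℝ) : rotX θ = hadamard * rotZ θ * hadamard := by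
  rw [rotZ_eq_diagonal, hadamard_conj_diagonal, ← neg_mul, Complex.exp_mul_I, Complex.exp_mul_I,
    Complex.cos_neg, Complex.sin_neg, rotX]
  ext i j
  fin_cases i <;> fin_cases j <;> simp <;> ring

lemma rotZ_add (χ ξ : ℝ) : rotZ (χ + ξ) = rotZ χ * rotZ ξ := by
  ext i j
  fin_cases i <;> fin_cases j <;>
    simp [rotZ, Matrix.mul_apply, Fin.sum_univ_two, ← Complex.exp_add] <;> ring_nf

lemma rotZ_zero : rotZ 0 = 1 := by
  ext i j
  fin_cases i <;> fin_cases j <;> simp [rotZ]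

lemma star_rotZ (χ : ℝ) : star (rotZ χ) = rotZ (-χ) := by
  ext i j
  fin_cases i <;> fin_cases j <;>
    simp [rotZ, Matrix.star_apply, ← Complex.exp_conj]

lemma rotZ_mem (χ : ℝ) : rotZ χ ∈ Matrix.unitaryGroup (Fin 2) ℂ := by
  rw [Matrix.mem_unitaryGroup_iff, star_rotZ, ← rotZ_add, add_neg_cancel, rotZ_zero]

lemma rotX_add (χ ξ : ℝ) : rotX (χ + ξ) = rotX χ * rotX ξ := by
  have h : hadamard * rotZ χ * hadamard * (hadamard * rotZ ξ * hadamard) =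
      hadamard * rotZ χ * (hadamard * hadamard) * rotZ ξ * hadamard := by
    simp only [mul_assoc]
  rw [rotX_eq, rotX_eq, rotX_eq, h, hadamard_mul_self, mul_one, rotZ_add, ← mul_assoc]

lemma rotX_zero : rotX 0 = 1 := by
  rw [rotX_eq, rotZ_zero, mul_one, hadamard_mul_self]

lemma rotX_mem (θ : ℝ) : rotX θ ∈ Matrix.unitaryGroup (Fin 2) ℂ := by
  rw [rotX_eq]
  exact mul_mem (mul_mem hadamard_mem (rotZ_mem θ)) hadamard_mem

/-- Sum and difference of two angles are arbitrary, so local Z-rotations rotate the even and odd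
blocks independently. -/
lemma rotZ_kronecker (χ₁ χ₂ : ℝ) :
    rotZ χ₁ ⊗ₖ rotZ χ₂ = ppGate (rotZ (χ₁ + χ₂)) (rotZ (χ₁ - χ₂)) := by
  ext ⟨p, q⟩ ⟨r, s⟩
  fin_cases p <;> fin_cases q <;> fin_cases r <;> fin_cases s <;>
    simp [ppGate, rotZ, ← Complex.exp_add] <;> ring_nf

/-- X⊗X, Y⊗Y and Z⊗Z restrict to X, -X, 1 on the even block and X, X, -1 on the odd one. A Hadamard
in each block diagonalizes the exponent, and the exponential is then taken entrywise. -/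
lemma nonlocalCore_eq (a b c : ℝ) : nonlocalCore a b c =
    ppGate (Complex.exp (c * Complex.I) • rotX (a - b))
      (Complex.exp (-(c * Complex.I)) • rotX (a + b)) := by
  set B : Op2 := ppGate hadamard hadamard with hB
  have hBB : B * B = 1 := by rw [hB, ppGate_mul, hadamard_mul_self, ppGate_one]
  set d : Fin 2 × Fin 2 → ℂ := fun p => if p.1 = p.2 then
      ![(c + (a - b)) * Complex.I, (c - (a - b)) * Complex.I] p.1 else
      ![(-c + (a + b)) * Complex.I, (-c - (a + b)) * Complex.I] p.1 with hd
  have hdiag (x y z w : ℂ) : Matrix.diagonal (fun p : Fin 2 × Fin 2 =>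
      if p.1 = p.2 then ![x, y] p.1 else ![z, w] p.1) =
      ppGate (Matrix.diagonal ![x, y]) (Matrix.diagonal ![z, w]) := by
    ext ⟨p, q⟩ ⟨r, s⟩
    fin_cases p <;> fin_cases q <;> fin_cases r <;> fin_cases s <;> simp [ppGate]
  have hM : Complex.I • ((a : ℂ) • (pauliX ⊗ₖ pauliX) + (b : ℂ) • (pauliY ⊗ₖ pauliY) +
      (c : ℂ) • (pauliZ ⊗ₖ pauliZ)) = B * Matrix.diagonal d * B := by
    rw [hd, hdiag, hB, ppGate_mul, ppGate_mul, hadamard_conj_diagonal, hadamard_conj_diagonal]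
    ext ⟨p, q⟩ ⟨r, s⟩
    fin_cases p <;> fin_cases q <;> fin_cases r <;> fin_cases s <;>
      simp [ppGate, pauliX, pauliY, pauliZ] <;> ring
  have hexp : NormedSpace.exp (B * Matrix.diagonal d * B) =
      B * NormedSpace.exp (Matrix.diagonal d) * B :=
    Matrix.exp_units_conj (⟨B, B, hBB, hBB⟩ : Op2ˣ) (Matrix.diagonal d)
  have hed : NormedSpace.exp d = fun p : Fin 2 × Fin 2 =>
      if p.1 = p.2 then ![Complex.exp ((c + (a - b)) * Complex.I),
        Complex.exp ((c - (a - b)) * Complex.I)] p.1 else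
      ![Complex.exp ((-c + (a + b)) * Complex.I),
        Complex.exp ((-c - (a + b)) * Complex.I)] p.1 := by
    funext ⟨p, q⟩
    rw [Pi.coe_exp, ← Complex.exp_eq_exp_ℂ]
    fin_cases p <;> fin_cases q <;> simp [hd]
  rw [nonlocalCore, hM, hexp, Matrix.exp_diagonal, hed, hdiag, hB, ppGate_mul, ppGate_mul]
  congr 1
  · rw [rotX_eq, ← Matrix.smul_mul, ← Matrix.mul_smul, rotZ_eq_diagonal, ← Matrix.diagonal_smul]
    congr 3
    funext i
    fin_cases i <;> simp [← Complex.exp_add] <;> ring_nf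
  · rw [rotX_eq, ← Matrix.smul_mul, ← Matrix.mul_smul, rotZ_eq_diagonal, ← Matrix.diagonal_smul]
    congr 3
    funext i
    fin_cases i <;> simp [← Complex.exp_add] <;> ring_nf

lemma smul_mem_unitaryGroup {ι : Type*} [Fintype ι] [DecidableEq ι] {A : Matrix ι ι ℂ} (θ : ℝ)
    (hA : A ∈ Matrix.unitaryGroup ι ℂ) :
    Complex.exp (θ * Complex.I) • A ∈ Matrix.unitaryGroup ι ℂ := by
  rw [Matrix.mem_unitaryGroup_iff'] at hA ⊢
  rw [star_smul, Matrix.smul_mul, Matrix.mul_smul, smul_smul, hA, exp_mem_unitary, one_smul]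

/-- The blocks of a gate with given nonlocal parameters. -/
lemma hasParams_eq_ppGate {U : Op2} {a b c : ℝ} (h : HasParams U a b c) :
    ∃ δ χ χ' ξ ξ' : ℝ, U = ppGate
      (Complex.exp ((δ + c : ℝ) * Complex.I) • (rotZ χ * rotX (a - b) * rotZ ξ))
      (Complex.exp ((δ - c : ℝ) * Complex.I) • (rotZ χ' * rotX (a + b) * rotZ ξ')) := by
  obtain ⟨δ, χ₁, χ₂, ξ₁, ξ₂, rfl⟩ := h
  refine ⟨δ, χ₁ + χ₂, χ₁ - χ₂, ξ₁ + ξ₂, ξ₁ - ξ₂, ?_⟩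
  rw [rotZ_kronecker, rotZ_kronecker, nonlocalCore_eq, ppGate_mul, ppGate_mul, ← ppGate_smul]
  simp only [Matrix.smul_mul, Matrix.mul_smul, smul_smul, ← Complex.exp_add]
  congr 3
  · push_cast; ring_nf
  · push_cast; ring_nf

lemma hasParams_of_eq_ppGate {U : Op2} {a b c δ χ χ' ξ ξ' : ℝ} (h : U = ppGate
      (Complex.exp ((δ + c : ℝ) * Complex.I) • (rotZ χ * rotX (a - b) * rotZ ξ))
      (Complex.exp ((δ - c : ℝ) * Complex.I) • (rotZ χ' * rotX (a + b) * rotZ ξ'))) :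
    HasParams U a b c := by
  refine ⟨δ, (χ + χ') / 2, (χ - χ') / 2, (ξ + ξ') / 2, (ξ - ξ') / 2, ?_⟩
  rw [h, rotZ_kronecker, rotZ_kronecker, nonlocalCore_eq, ppGate_mul, ppGate_mul, ← ppGate_smul]
  simp only [Matrix.smul_mul, Matrix.mul_smul, smul_smul, ← Complex.exp_add]
  congr 4
  · push_cast; ring_nf
  · ring_nf
  · ring_nf
  · push_cast; ring_nf
  · ring_nf
  · ring_nf

lemma HasParams.isPP {U : Op2} {a b c : ℝ} (h : HasParams U a b c) : IsPP U := by
  obtain ⟨δ, χ, χ', ξ, ξ', rfl⟩ := hasParams_eq_ppGate h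
  exact ⟨_, smul_mem_unitaryGroup _ (mul_mem (mul_mem (rotZ_mem _) (rotX_mem _)) (rotZ_mem _)),
    _, smul_mem_unitaryGroup _ (mul_mem (mul_mem (rotZ_mem _) (rotX_mem _)) (rotZ_mem _)), rfl⟩

/-- R_z(π/2) = iZ, and Z anticommutes with X. -/
lemma rotX_neg_eq (θ : ℝ) :
    rotX (-θ) = rotZ (Real.pi / 2) * rotX θ * rotZ (-(Real.pi / 2)) := by
  have h1 : Complex.exp (Real.pi / 2 * Complex.I) = Complex.I := Complex.exp_pi_div_two_mul_I
  have h2 : Complex.exp (-(Real.pi / 2 * Complex.I)) = -Complex.I := by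
    rw [Complex.exp_neg, h1, Complex.inv_I]
  ext i j
  fin_cases i <;> fin_cases j <;>
    simp [rotX, rotZ, Matrix.mul_apply, Fin.sum_univ_two, h1, h2] <;> ring_nf <;>
    simp [Complex.I_sq, Complex.I_pow_three]

/-- With a = 0 the block angles are -b and b; with b = 0 they are a and a. The sign in the even
block is absorbed into Z-rotations of that block alone. -/
theorem Ma_eq_Mb : Ma = Mb := by
  ext U
  constructor
  · rintro ⟨hU, b, c, h⟩
    obtain ⟨δ, χ, χ', ξ, ξ', rfl⟩ := hasParams_eq_ppGate h
    refine ⟨hU, b, c, hasParams_of_eq_ppGate (δ := δ) (χ := χ + Real.pi / 2) (χ' := χ')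
      (ξ := -(Real.pi / 2) + ξ) (ξ' := ξ') ?_⟩
    rw [zero_sub, zero_add, sub_zero, add_zero, rotX_neg_eq, rotZ_add χ, rotZ_add _ ξ]
    simp only [mul_assoc]
  · rintro ⟨hU, a, c, h⟩
    obtain ⟨δ, χ, χ', ξ, ξ', rfl⟩ := hasParams_eq_ppGate h
    refine ⟨hU, a, c, hasParams_of_eq_ppGate (δ := δ) (χ := χ + Real.pi / 2) (χ' := χ')
      (ξ := -(Real.pi / 2) + ξ) (ξ' := ξ') ?_⟩
    have : rotX a = rotZ (Real.pi / 2) * rotX (-a) * rotZ (-(Real.pi / 2)) := by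
      rw [← rotX_neg_eq, neg_neg]
    rw [zero_sub, zero_add, sub_zero, add_zero, rotZ_add χ, rotZ_add _ ξ]
    congr 2
    rw [this]
    simp only [mul_assoc]

/-- Euler angles for `U(2)`. -/
lemma exists_euler {A : Op1} (hA : A ∈ Matrix.unitaryGroup (Fin 2) ℂ) :
    ∃ δ χ a ξ : ℝ, A = Complex.exp (δ * Complex.I) • (rotZ χ * rotX a * rotZ ξ) := by
  have h1 : star A * A = 1 := Matrix.mem_unitaryGroup_iff'.1 hA
  have hadj : A.adjugate = A.det • star A := by
    -- The adjugate of a unitary is its determinant times its adjoint, so the second column is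
    -- determined by the first one and the determinant.
    rw [← one_mul A.adjugate, ← h1, mul_assoc, Matrix.mul_adjugate, Matrix.mul_smul, mul_one]
  have hdet : ‖A.det‖ = 1 := by
    have := Matrix.det_of_mem_unitary hA
    exact CStarRing.norm_of_mem_unitary this
  have h00 := congrFun (congrFun h1 0) 0
  have hs := congrFun (congrFun hadj 0) 0
  have hq := congrFun (congrFun hadj 0) 1
  rw [Matrix.adjugate_fin_two] at hs hq
  simp only [Matrix.mul_apply, Matrix.star_apply, Fin.sum_univ_two, Matrix.smul_apply,
    Matrix.of_apply, Matrix.cons_val', Matrix.cons_val_zero, Matrix.cons_val_one,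
    Matrix.cons_val_fin_one, smul_eq_mul, Matrix.one_apply_eq, Complex.star_def,
    Complex.conj_mul'] at h00 hs hq
  set p := A 0 0
  set r := A 1 0
  set z : ℂ := ‖p‖ + ‖r‖ * Complex.I with hz
  have hz1 : ‖z‖ = 1 := by
    have h2 : ‖z‖ ^ 2 = 1 := by
      rw [Complex.sq_norm, hz, Complex.normSq_add_mul_I]
      exact_mod_cast h00
    nlinarith [norm_nonneg z]
  have hc : (‖p‖ : ℂ) = Complex.cos z.arg := by
    have := Complex.norm_mul_cos_arg z
    rw [hz1, one_mul] at this
    rw [← Complex.ofReal_cos, this, hz]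
    simp
  have hsn : (‖r‖ : ℂ) = Complex.sin z.arg := by
    have := Complex.norm_mul_sin_arg z
    rw [hz1, one_mul] at this
    rw [← Complex.ofReal_sin, this, hz]
    simp
  have hp : p = Complex.cos z.arg * Complex.exp (p.arg * Complex.I) := by
    rw [← hc, Complex.norm_mul_exp_arg_mul_I]
  have hr : r = Complex.sin z.arg * Complex.exp (r.arg * Complex.I) := by
    rw [← hsn, Complex.norm_mul_exp_arg_mul_I]
  have hd : A.det = Complex.exp (A.det.arg * Complex.I) := by
    conv_lhs => rw [← Complex.norm_mul_exp_arg_mul_I A.det, hdet]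
    simp
  have hcc (x : ℝ) : (starRingEnd ℂ) (Complex.exp (x * Complex.I)) =
      Complex.exp (-(x * Complex.I)) := by
    rw [← Complex.exp_conj]; simp
  have hp' : (starRingEnd ℂ) p = Complex.cos z.arg * Complex.exp (-(p.arg * Complex.I)) := by
    conv_lhs => rw [hp, map_mul, hcc, ← Complex.ofReal_cos, Complex.conj_ofReal]
    rw [Complex.ofReal_cos]
  have hr' : (starRingEnd ℂ) r = Complex.sin z.arg * Complex.exp (-(r.arg * Complex.I)) := by
    conv_lhs => rw [hr, map_mul, hcc, ← Complex.ofReal_sin, Complex.conj_ofReal]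
    rw [Complex.ofReal_sin]
  rw [hp', hd] at hs
  rw [hr', hd] at hq
  set α := p.arg
  set β := r.arg
  set ω := A.det.arg
  set φ := z.arg
  have hI : Complex.exp (Real.pi / 2 * Complex.I) = Complex.I := Complex.exp_pi_div_two_mul_I
  have hI' : Complex.exp (-(Real.pi / 2 * Complex.I)) = -Complex.I := by
    rw [Complex.exp_neg, hI, Complex.inv_I]
  have hII := Complex.I_mul_I
  -- Matching determinants gives δ = ω/2. The phases of the first column give δ + χ + ξ = α and δ -
  -- χ + ξ = β - π/2, the latter because the off-diagonal entry of e^{iφX} carries a factor i.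
  refine ⟨ω / 2, (α - β + Real.pi / 2) / 2, φ, α - ω / 2 - (α - β + Real.pi / 2) / 2, ?_⟩
  set χ := (α - β + Real.pi / 2) / 2 with hχ
  have e00 : Complex.exp ((ω / 2 : ℝ) * Complex.I) * Complex.exp (χ * Complex.I) *
      Complex.exp ((α - ω / 2 - χ : ℝ) * Complex.I) = Complex.exp (α * Complex.I) := by
    rw [← Complex.exp_add, ← Complex.exp_add]
    congr 1
    push_cast
    ring
  have e01 : Complex.exp ((ω / 2 : ℝ) * Complex.I) * Complex.exp (χ * Complex.I) *
      Complex.exp (-((α - ω / 2 - χ : ℝ) * Complex.I)) =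
      Complex.exp (ω * Complex.I) * Complex.exp (-(β * Complex.I)) *
        Complex.exp (Real.pi / 2 * Complex.I) := by
    rw [← Complex.exp_add, ← Complex.exp_add, ← Complex.exp_add, ← Complex.exp_add, hχ]
    congr 1
    push_cast
    ring
  rw [hI] at e01
  have e10 : Complex.exp ((ω / 2 : ℝ) * Complex.I) * Complex.exp (-(χ * Complex.I)) *
      Complex.exp ((α - ω / 2 - χ : ℝ) * Complex.I) =
      Complex.exp (β * Complex.I) * -Complex.I := by
    rw [← hI', ← Complex.exp_add, ← Complex.exp_add, ← Complex.exp_add, hχ]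
    congr 1
    push_cast
    ring
  have e11 : Complex.exp ((ω / 2 : ℝ) * Complex.I) * Complex.exp (-(χ * Complex.I)) *
      Complex.exp (-((α - ω / 2 - χ : ℝ) * Complex.I)) =
      Complex.exp (ω * Complex.I) * Complex.exp (-(α * Complex.I)) := by
    rw [← Complex.exp_add, ← Complex.exp_add, ← Complex.exp_add]
    congr 1
    push_cast
    ring
  have hA : A = !![p, A 0 1; r, A 1 1] := Matrix.eta_fin_two A
  have hq' : A 0 1 = -(Complex.exp (ω * Complex.I) *
      (Complex.sin φ * Complex.exp (-(β * Complex.I)))) := by rw [← hq, neg_neg]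
  rw [hA, hq', hs, hp, hr, rotX, rotZ, rotZ]
  simp only [Matrix.mul_fin_two, Matrix.smul_of, Matrix.smul_cons, Matrix.smul_empty, smul_eq_mul,
    mul_zero, zero_mul, add_zero, zero_add]
  congr 1
  ext i j
  fin_cases i <;> fin_cases j
  · simp only [Fin.zero_eta, Matrix.cons_val_zero]
    linear_combination -Complex.cos φ * e00
  · simp only [Fin.zero_eta, Fin.mk_one, Matrix.cons_val_zero, Matrix.cons_val_one]
    linear_combination -Complex.I * Complex.sin φ * e01 -
      Complex.exp (ω * Complex.I) * Complex.exp (-(β * Complex.I)) * Complex.sin φ * hII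
  · simp only [Fin.zero_eta, Fin.mk_one, Matrix.cons_val_zero, Matrix.cons_val_one]
    linear_combination -Complex.I * Complex.sin φ * e10 +
      Complex.exp (β * Complex.I) * Complex.sin φ * hII
  · simp only [Fin.mk_one, Matrix.cons_val_one, Matrix.cons_val_fin_one]
    linear_combination -Complex.cos φ * e11

theorem constructionSet_subset_Mb {g : Op2} {a c : ℝ} (hg : HasParams g a 0 c) :
    constructionSet g ⊆ Mb := by
  rintro U ((⟨A, hA, rfl⟩ | ⟨χ₁, χ₂, rfl⟩) | rfl)
  · obtain ⟨δ, χ, a, ξ, h⟩ := exists_euler hA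
    refine ⟨⟨A, hA, A, hA, rfl⟩, a, 0, hasParams_of_eq_ppGate (δ := δ) (χ := χ) (χ' := χ)
      (ξ := ξ) (ξ' := ξ) ?_⟩
    rw [add_zero, sub_zero, sub_zero, add_zero, ← h]
  · have h : HasParams (rotZ χ₁ ⊗ₖ rotZ χ₂) 0 0 0 := by
      refine hasParams_of_eq_ppGate (δ := 0) (χ := χ₁ + χ₂) (χ' := χ₁ - χ₂) (ξ := 0) (ξ' := 0) ?_
      simp [rotZ_zero, rotX_zero, rotZ_kronecker]
    exact ⟨h.isPP, 0, 0, h⟩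
  · exact ⟨hg.isPP, a, c, hg⟩

/-! ### The encoding -/

/-- The physical bit string encoding the logical bit string `x`. -/
def enc {n : ℕ} (x : Bits n) : Bits (2 * n) := fun k => x ⟨k / 2, by omega⟩

lemma enc_even {n : ℕ} (x : Bits n) (i : Fin n) : enc x ⟨2 * i, by omega⟩ = x i := by
  rw [enc]
  congr 1
  ext
  simp

lemma enc_odd {n : ℕ} (x : Bits n) (i : Fin n) : enc x ⟨2 * i + 1, by omega⟩ = x i := by
  rw [enc]
  congr 1
  ext
  simp only
  omega

lemma eq_enc_iff {n : ℕ} {y : Bits (2 * n)} {x : Bits n} : y = enc x ↔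
    ∀ i : Fin n, y ⟨2 * i, by omega⟩ = x i ∧ y ⟨2 * i + 1, by omega⟩ = x i := by
  constructor
  · rintro rfl i
    exact ⟨enc_even x i, enc_odd x i⟩
  · intro h
    funext k
    have hk := h ⟨k / 2, by omega⟩
    rcases Nat.even_or_odd' (k : ℕ) with ⟨c, hc | hc⟩
    · rw [enc, ← hk.1]
      congr 1
      ext
      simp only
      omega
    · rw [enc, ← hk.2]
      congr 1
      ext
      simp only
      omega

lemma enc_injective {n : ℕ} : Function.Injective (enc (n := n)) := by
  intro x y h
  funext i
  rw [← enc_even x i, h, enc_even]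

lemma encode_apply {n : ℕ} (y : Bits (2 * n)) (x : Bits n) :
    encode n y x = if y = enc x then 1 else 0 :=
  if_congr eq_enc_iff.symm rfl rfl

lemma mul_encode_apply {n : ℕ} (W : Op (2 * n)) (y : Bits (2 * n)) (x : Bits n) :
    (W * encode n) y x = W y (enc x) := by
  rw [Matrix.mul_apply]
  simp [encode_apply]

lemma encode_mul_enc {n : ℕ} (U : Op n) (w x : Bits n) : (encode n * U) (enc w) x = U w x := by
  rw [Matrix.mul_apply]
  simp [encode_apply, enc_injective.eq_iff]

lemma encode_mul_of_forall_ne {n : ℕ} (U : Op n) {y : Bits (2 * n)} (hy : ∀ w, y ≠ enc w)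
    (x : Bits n) : (encode n * U) y x = 0 := by
  rw [Matrix.mul_apply]
  simp [encode_apply, hy]

/-! ### Matchgates are not universal -/

/-- A quadratic form on the even-parity states of four qubits, multiplied by a scalar under every
matchgate acting on nearest neighbours. -/
def quadForm (ψ : Bits 4 → ℂ) : ℂ :=
  ψ ![0, 0, 0, 0] * ψ ![1, 1, 1, 1] - ψ ![0, 0, 1, 1] * ψ ![1, 1, 0, 0] +
    ψ ![0, 1, 0, 1] * ψ ![1, 0, 1, 0] - ψ ![0, 1, 1, 0] * ψ ![1, 0, 0, 1]

/-- For each adjacent pair of sites the four terms group into two 2×2 minors, up to sign: one in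
amplitudes even on the pair, one in amplitudes odd on it. For sites 0 and 1 these are ψ₀₀₀₀ψ₁₁₁₁ -
ψ₁₁₀₀ψ₀₀₁₁ and ψ₀₁₀₁ψ₁₀₁₀ - ψ₁₀₀₁ψ₀₁₁₀. The gate multiplies them by det A and det B, which agree. -/
lemma quadForm_onPair {A B : Op1} (h : A.det = B.det) {k : ℕ} (hk : k + 1 < 4) (ψ : Bits 4 → ℂ) :
    quadForm ((onPair (⟨k, Nat.lt_of_succ_lt hk⟩ : Fin 4) ⟨k + 1, hk⟩ (ppGate A B)).mulVec ψ) =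
      A.det * quadForm ψ := by
  have h01 (a b c d : Fin 2) (p : Fin 2 × Fin 2) :
      setPair (0 : Fin 4) 1 ![a, b, c, d] p = ![p.1, p.2, c, d] := by
    funext i; fin_cases i <;> simp [setPair, Function.update]
  have h12 (a b c d : Fin 2) (p : Fin 2 × Fin 2) :
      setPair (1 : Fin 4) 2 ![a, b, c, d] p = ![a, p.1, p.2, d] := by
    funext i; fin_cases i <;> simp [setPair, Function.update]
  have h23 (a b c d : Fin 2) (p : Fin 2 × Fin 2) :
      setPair (2 : Fin 4) 3 ![a, b, c, d] p = ![a, b, p.1, p.2] := by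
    funext i; fin_cases i <;> simp [setPair, Function.update]
  rw [Matrix.det_fin_two, Matrix.det_fin_two] at h
  rw [Matrix.det_fin_two]
  have hk' : k < 3 := by omega
  interval_cases k
  · have hs := fun y => sum_onPair (m := 4) (i := 0) (j := 1) (by decide) (ppGate A B) y ψ
    simp [quadForm, Matrix.mulVec, dotProduct, hs, h01, Fintype.sum_prod_type, ppGate]
    linear_combination (ψ ![0, 1, 1, 0] * ψ ![1, 0, 0, 1] - ψ ![0, 1, 0, 1] * ψ ![1, 0, 1, 0]) * h
  · have hs := fun y => sum_onPair (m := 4) (i := 1) (j := 2) (by decide) (ppGate A B) y ψ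
    simp [quadForm, Matrix.mulVec, dotProduct, hs, h12, Fintype.sum_prod_type, ppGate]
    linear_combination (ψ ![0, 0, 1, 1] * ψ ![1, 1, 0, 0] - ψ ![0, 1, 0, 1] * ψ ![1, 0, 1, 0]) * h
  · have hs := fun y => sum_onPair (m := 4) (i := 2) (j := 3) (by decide) (ppGate A B) y ψ
    simp [quadForm, Matrix.mulVec, dotProduct, hs, h23, Fintype.sum_prod_type, ppGate]
    linear_combination (ψ ![0, 1, 1, 0] * ψ ![1, 0, 0, 1] - ψ ![0, 1, 0, 1] * ψ ![1, 0, 1, 0]) * h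

lemma det_rotZ (χ : ℝ) : (rotZ χ).det = 1 := by
  simp [rotZ, Matrix.det_fin_two, ← Complex.exp_add]

lemma det_rotX (θ : ℝ) : (rotX θ).det = 1 := by
  simp [rotX, Matrix.det_fin_two]
  linear_combination Complex.sin_sq_add_cos_sq (θ : ℂ) - Complex.sin θ ^ 2 * Complex.I_mul_I

/-- The rotations have determinant 1, and c = 0 gives both blocks the same phase, so both
determinants are e^{2iδ}. -/
lemma Mc_blocks {U : Op2} (h : U ∈ Mc) : ∃ A B : Op1, A.det = B.det ∧ U = ppGate A B := by
  obtain ⟨-, a, b, h⟩ := h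
  obtain ⟨δ, χ, χ', ξ, ξ', rfl⟩ := hasParams_eq_ppGate h
  refine ⟨_, _, ?_, rfl⟩
  simp only [Matrix.det_smul, Matrix.det_mul, det_rotZ, det_rotX, add_zero, sub_zero]

lemma quadForm_circuit {L : List (Op 4)} (hL : IsCircuit (nearestNeighbourGates Mc 4) L) :
    ∃ d : ℂ, ∀ ψ, quadForm (L.prod.mulVec ψ) = d * quadForm ψ := by
  induction L with
  | nil => exact ⟨1, by simp⟩
  | cons M L ih =>
    obtain ⟨d, hd⟩ := ih fun M hM => hL M (List.mem_cons_of_mem _ hM)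
    obtain ⟨k, hk, G, hG, rfl⟩ := hL M List.mem_cons_self
    obtain ⟨A, B, hAB, rfl⟩ := Mc_blocks hG
    refine ⟨A.det * d, fun ψ => ?_⟩
    rw [List.prod_cons, ← Matrix.mulVec_mulVec, quadForm_onPair hAB, hd, mul_assoc]

theorem not_approxUniversal_Mc : ¬ ApproxUniversal Mc := by
  intro h
  -- A rational rotation: the logical gate sends |00⟩ to (3/5)|00⟩ + (4/5)|11⟩, whose encoding has
  -- form value 12/25 instead of 0.
  set A : Op1 := !![3 / 5, -4 / 5; 4 / 5, 3 / 5] with hA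
  have hAu : A ∈ Matrix.unitaryGroup (Fin 2) ℂ := by
    rw [Matrix.mem_unitaryGroup_iff]
    ext i j
    fin_cases i <;> fin_cases j <;>
      norm_num [hA, Matrix.mul_apply, Fin.sum_univ_two, Matrix.star_apply, map_ofNat]
  have hG : ppGate A 1 ∈ Matrix.unitaryGroup (Fin 2 × Fin 2) ℂ := by
    rw [Matrix.mem_unitaryGroup_iff] at hAu ⊢
    rw [star_ppGate, ppGate_mul, hAu, star_one, mul_one, ppGate_one]
  set V : Op 2 := onPair 0 1 (ppGate A 1) with hV
  obtain ⟨L, hL, z, hz, hW⟩ := h 2 V (onPair_mem_unitaryGroup (by decide) hG) (1 / 10)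
    (by norm_num)
  obtain ⟨d, hd⟩ := quadForm_circuit hL
  have hq := hd (Pi.single 0 1)
  set W : Op 4 := L.prod with hWdef
  set φ : Bits 4 → ℂ := fun y => (encode 2 * V) y 0 with hφ
  have hclose (y : Bits 4) : ‖W y 0 - z * φ y‖ ≤ 1 / 10 := by
    have := hW y 0
    rw [mul_encode_apply] at this
    exact this
  have hsmall (y : Bits 4) (hy : φ y = 0) : ‖W y 0‖ ≤ 1 / 10 := by
    have := hclose y
    rwa [hy, mul_zero, sub_zero] at this
  have hlarge (y : Bits 4) (r : ℝ) (hr : 0 ≤ r) (hy : φ y = r) : r - 1 / 10 ≤ ‖W y 0‖ := by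
    have h1 := hclose y
    rw [hy] at h1
    have h2 := norm_sub_norm_le (z * r) (W y 0)
    rw [norm_mul, hz, one_mul, Complex.norm_real, Real.norm_of_nonneg hr, norm_sub_rev] at h2
    linarith
  have henc (a b : Fin 2) : φ ![a, a, b, b] = V ![a, b] 0 := by
    rw [← encode_mul_enc V ![a, b] 0, hφ]
    congr 1
    funext i
    fin_cases i <;> rfl
  have hzero (y : Bits 4) (hy : y 0 ≠ y 1) : φ y = 0 := by
    refine encode_mul_of_forall_ne (n := 2) V ?_ 0
    rintro w rfl
    exact hy rfl
  have b0000 := hlarge ![0, 0, 0, 0] (3 / 5) (by norm_num)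
    (by rw [henc]; simp [hV, onPair, ppGate, hA, Fin.forall_fin_two])
  have b1111 := hlarge ![1, 1, 1, 1] (4 / 5) (by norm_num)
    (by rw [henc]; simp [hV, onPair, ppGate, hA, Fin.forall_fin_two])
  have b0011 := hsmall ![0, 0, 1, 1]
    (by rw [henc]; simp [hV, onPair, ppGate])
  have b1100 := hsmall ![1, 1, 0, 0]
    (by rw [henc]; simp [hV, onPair, ppGate])
  have b0101 := hsmall ![0, 1, 0, 1] (hzero _ (by simp))
  have b1010 := hsmall ![1, 0, 1, 0] (hzero _ (by simp))
  have b0110 := hsmall ![0, 1, 1, 0] (hzero _ (by simp))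
  have b1001 := hsmall ![1, 0, 0, 1] (hzero _ (by simp))
  have hq0 : quadForm (Pi.single 0 1) = 0 := by simp [quadForm]
  have hcol (y : Bits 4) : W.mulVec (Pi.single 0 1) y = W y 0 := by simp
  rw [hq0, mul_zero, quadForm] at hq
  simp only [hcol] at hq
  have hprod : W ![0, 0, 0, 0] 0 * W ![1, 1, 1, 1] 0 =
      W ![0, 0, 1, 1] 0 * W ![1, 1, 0, 0] 0 - W ![0, 1, 0, 1] 0 * W ![1, 0, 1, 0] 0 +
        W ![0, 1, 1, 0] 0 * W ![1, 0, 0, 1] 0 := by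
    linear_combination hq
  have hn := congrArg norm hprod
  rw [norm_mul] at hn
  have h1 := norm_add_le (W ![0, 0, 1, 1] 0 * W ![1, 1, 0, 0] 0 -
    W ![0, 1, 0, 1] 0 * W ![1, 0, 1, 0] 0) (W ![0, 1, 1, 0] 0 * W ![1, 0, 0, 1] 0)
  have h2 := norm_sub_le (W ![0, 0, 1, 1] 0 * W ![1, 1, 0, 0] 0)
    (W ![0, 1, 0, 1] 0 * W ![1, 0, 1, 0] 0)
  have hmul {p q : ℂ} (hp : ‖p‖ ≤ 1 / 10) (hq : ‖q‖ ≤ 1 / 10) : ‖p * q‖ ≤ 1 / 10 * (1 / 10) := by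
    rw [norm_mul]
    exact mul_le_mul hp hq (norm_nonneg _) (by norm_num)
  have h3 := hmul b0011 b1100
  have h4 := hmul b0101 b1010
  have h5 := hmul b0110 b1001
  -- With error 1/10 per entry the leading product is at least 7/20, while the other three products
  -- total at most 3/100, so the form cannot vanish.
  have h6 : (3 / 5 - 1 / 10 : ℝ) * (4 / 5 - 1 / 10) ≤ ‖W ![0, 0, 0, 0] 0‖ * ‖W ![1, 1, 1, 1] 0‖ :=
    mul_le_mul b0000 b1111 (by norm_num) (norm_nonneg _)
  linarith

/-! ### Cost of implementing logical operators -/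

/-- `U` is implemented by a nearest-neighbour circuit of at most `k` gates of `S`. -/
def Cost (S : Set Op2) (n k : ℕ) (U : Op n) : Prop :=
  ∃ L, IsCircuit (nearestNeighbourGates S (2 * n)) L ∧ Implements L.prod U ∧ L.length ≤ k

lemma Cost.mono {S : Set Op2} {n k l : ℕ} {U : Op n} (h : Cost S n k U) (hkl : k ≤ l) :
    Cost S n l U := by
  obtain ⟨L, hL, hi, hl⟩ := h
  exact ⟨L, hL, hi, hl.trans hkl⟩

lemma Cost.one {S : Set Op2} {n : ℕ} : Cost S n 0 1 :=
  ⟨[], by simp [IsCircuit], ⟨1, by simp, by simp⟩, le_rfl⟩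

lemma Cost.mul {S : Set Op2} {n k l : ℕ} {U V : Op n} (hU : Cost S n k U) (hV : Cost S n l V) :
    Cost S n (k + l) (U * V) := by
  obtain ⟨K, hK, ⟨z, hz, hKU⟩, hk⟩ := hU
  obtain ⟨L, hL, ⟨w, hw, hLV⟩, hl⟩ := hV
  refine ⟨K ++ L, fun M hM => ?_, ⟨z * w, by rw [norm_mul, hz, hw, one_mul], ?_⟩, ?_⟩
  · rcases List.mem_append.1 hM with h | h
    exacts [hK M h, hL M h]
  · rw [List.prod_append, Matrix.mul_assoc, hLV, Matrix.mul_smul, ← Matrix.mul_assoc, hKU,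
      Matrix.smul_mul, smul_smul, mul_comm w z, Matrix.mul_assoc]
  · rw [List.length_append]
    exact add_le_add hk hl

lemma Cost.list_prod {S : Set Op2} {n k : ℕ} {K : List (Op n)} (h : ∀ M ∈ K, Cost S n k M) :
    Cost S n (k * K.length) K.prod := by
  induction K with
  | nil => exact Cost.one
  | cons M K ih =>
    rw [List.prod_cons, List.length_cons, mul_add, mul_one, add_comm]
    exact (h M List.mem_cons_self).mul (ih fun M hM => h M (List.mem_cons_of_mem _ hM))

/-- On any two neighbouring logical qubits, `G` costs at most `k` gates of `S`. -/
def PairCost (S : Set Op2) (k : ℕ) (G : Op2) : Prop :=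
  ∀ (n i : ℕ) (hi : i + 1 < n),
    Cost S n k (onPair (⟨i, Nat.lt_of_succ_lt hi⟩ : Fin n) ⟨i + 1, hi⟩ G)

lemma mk_ne_mk_succ {n i : ℕ} (hi : i + 1 < n) :
    (⟨i, Nat.lt_of_succ_lt hi⟩ : Fin n) ≠ ⟨i + 1, hi⟩ := by
  simp [Fin.ext_iff]

lemma PairCost.one {S : Set Op2} : PairCost S 0 1 := by
  intro n i hi
  rw [onPair_one]
  exact Cost.one

lemma PairCost.mono {S : Set Op2} {k l : ℕ} {G : Op2} (h : PairCost S k G) (hkl : k ≤ l) :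
    PairCost S l G :=
  fun n i hi => (h n i hi).mono hkl

lemma PairCost.mul {S : Set Op2} {k l : ℕ} {G H : Op2} (hG : PairCost S k G)
    (hH : PairCost S l H) : PairCost S (k + l) (G * H) := by
  intro n i hi
  rw [onPair_mul (mk_ne_mk_succ hi)]
  exact (hG n i hi).mul (hH n i hi)

/-- Every one-qubit unitary costs one gate of `S`. -/
def LocalCost (S : Set Op2) : Prop :=
  ∀ (n : ℕ) (i : Fin n), ∀ A ∈ Matrix.unitaryGroup (Fin 2) ℂ, Cost S n 1 (onQubit i A)

lemma LocalCost.left {S : Set Op2} (hS : LocalCost S) {A : Op1}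
    (hA : A ∈ Matrix.unitaryGroup (Fin 2) ℂ) : PairCost S 1 (A ⊗ₖ (1 : Op1)) := by
  intro n i hi
  rw [onPair_kronecker_one (mk_ne_mk_succ hi)]
  exact hS n _ A hA

lemma LocalCost.right {S : Set Op2} (hS : LocalCost S) {A : Op1}
    (hA : A ∈ Matrix.unitaryGroup (Fin 2) ℂ) : PairCost S 1 ((1 : Op1) ⊗ₖ A) := by
  intro n i hi
  rw [onPair_one_kronecker (mk_ne_mk_succ hi)]
  exact hS n _ A hA

/-! ### Universality from one-qubit unitaries and `CNOT`s -/

lemma onPair_swap {m : ℕ} (i j : Fin m) (G : Op2) :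
    onPair i j G = onPair j i (G.submatrix Prod.swap Prod.swap) := by
  ext y x
  simp only [onPair, Matrix.submatrix_apply, Prod.swap_prod_mk]
  exact if_congr ⟨fun h k hj hi => h k hi hj, fun h k hi hj => h k hj hi⟩ rfl rfl

lemma submatrix_equiv_mem {ι κ : Type*} [Fintype ι] [DecidableEq ι] [Fintype κ] [DecidableEq κ]
    (e : κ ≃ ι) {U : Matrix ι ι ℂ} (hU : U ∈ Matrix.unitaryGroup ι ℂ) :
    U.submatrix e e ∈ Matrix.unitaryGroup κ ℂ := by
  rw [Matrix.mem_unitaryGroup_iff, Matrix.star_eq_conjTranspose] at hU ⊢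
  rw [Matrix.conjTranspose_submatrix, Matrix.submatrix_mul_equiv, hU, Matrix.submatrix_one_equiv]

/-- Hadamards on both qubits exchange control and target. The factors 1/√2 are collected into
rational scalars before comparing entries. -/
lemma cnot_swap_eq : cnot.submatrix Prod.swap Prod.swap =
    (hadamard ⊗ₖ (1 : Op1)) * ((1 : Op1) ⊗ₖ hadamard) * cnot *
      ((hadamard ⊗ₖ (1 : Op1)) * ((1 : Op1) ⊗ₖ hadamard)) := by
  have h : (hadamard ⊗ₖ (1 : Op1)) * ((1 : Op1) ⊗ₖ hadamard) =
      (1 / 2 : ℂ) • ((!![1, 1; 1, -1] : Op1) ⊗ₖ (!![1, 1; 1, -1] : Op1)) := by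
    rw [← Matrix.mul_kronecker_mul, mul_one, one_mul, hadamard, Matrix.smul_kronecker,
      Matrix.kronecker_smul, smul_smul, sqrt_two_inv_mul_self]
  have h11 : (1 : Fin 2) + 1 = 0 := rfl
  rw [h, Matrix.smul_mul, Matrix.smul_mul, Matrix.mul_smul, smul_smul]
  ext ⟨p, q⟩ ⟨r, s⟩
  rw [Matrix.submatrix_apply, Matrix.smul_apply, Matrix.mul_apply]
  simp only [Matrix.mul_apply, Fintype.sum_prod_type, Fin.sum_univ_two, cnot_apply,
    Prod.swap_prod_mk, Matrix.kroneckerMap_apply]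
  fin_cases p <;> fin_cases q <;> fin_cases r <;> fin_cases s <;> norm_num [h11]

/-- Bounded generation is used here for n = 2 only, so the constant does not depend on the length of
the register. A CNOT in the reverse direction costs four extra Hadamards, whence `4 + c`. -/
lemma pairCost_unitary {S : Set Op2} (hS : LocalCost S) {c : ℕ} (hc : PairCost S c cnot) :
    ∃ k, ∀ G ∈ Matrix.unitaryGroup (Fin 2 × Fin 2) ℂ, PairCost S k G := by
  obtain ⟨k, hk⟩ := exists_basic_unitary (n := 2) (by norm_num)
  set e : Fin 2 × Fin 2 ≃ Bits 2 := (finTwoArrowEquiv (Fin 2)).symm with he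
  have hpair (G : Op2) : (onPair (0 : Fin 2) 1 G).submatrix e e = G := by
    ext ⟨p, q⟩ ⟨r, s⟩
    simp [onPair, he, Fin.forall_fin_two]
  have hbasic : ∀ M ∈ basicGates 2, PairCost S (4 + c) (M.submatrix e e) := by
    rintro M (⟨i, A, hA, rfl⟩ | ⟨i, j, hij, rfl⟩)
    · rcases Fin.exists_fin_two.1 ⟨i, rfl⟩ with rfl | rfl
      · rw [← onPair_kronecker_one (i := 0) (j := 1) (by decide), hpair]
        exact (hS.left hA).mono (by omega)
      · rw [← onPair_one_kronecker (i := 0) (j := 1) (by decide), hpair]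
        exact (hS.right hA).mono (by omega)
    · rcases Fin.exists_fin_two.1 ⟨i, rfl⟩ with rfl | rfl
      · obtain rfl : j = 1 := fin_two_eq_one hij.symm
        rw [hpair]
        exact hc.mono (by omega)
      · obtain rfl : j = 0 := by
          by_contra h
          exact hij (fin_two_eq_one h).symm
        rw [onPair_swap, hpair, cnot_swap_eq]
        have hH := (hS.left hadamard_mem).mul (hS.right hadamard_mem)
        exact ((hH.mul hc).mul hH).mono (by omega)
  have hlist (K : List (Op 2)) (hK : IsCircuit (basicGates 2) K) :
      PairCost S ((4 + c) * K.length) (K.prod.submatrix e e) := by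
    induction K with
    | nil =>
      rw [List.prod_nil, Matrix.submatrix_one_equiv]
      exact PairCost.one
    | cons M K ih =>
      rw [List.prod_cons, ← Matrix.submatrix_mul_equiv _ _ _ e _, List.length_cons, mul_add,
        mul_one, add_comm]
      exact (hbasic M (hK M List.mem_cons_self)).mul
        (ih fun M hM => hK M (List.mem_cons_of_mem _ hM))
  refine ⟨(4 + c) * k, fun G hG => ?_⟩
  obtain ⟨K, hK, hp, hl⟩ := hk (onPair 0 1 G) (onPair_mem_unitaryGroup (by decide) hG)
  have := hlist K hK
  rw [hp, hpair] at this
  exact this.mono (Nat.mul_le_mul_left _ hl)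

/-! ### Routing distant qubits by SWAPs -/

lemma mapOp_conj {n : ℕ} {σ : Bits n → Bits n} (h : Function.Involutive σ) (M : Op n) :
    mapOp σ * M * mapOp σ = fun y x => M (σ y) (σ x) := by
  ext y x
  have h1 (z : Bits n) : (mapOp σ * M) y z = M (σ y) z := by
    rw [Matrix.mul_apply, Finset.sum_eq_single (σ y)]
    · simp [mapOp, h y]
    · intro w _ hw
      have : y ≠ σ w := fun hy => hw (by rw [hy, h w])
      simp [mapOp, this]
    · simp
  rw [Matrix.mul_apply, Finset.sum_eq_single (σ x)]
  · simp [mapOp, h1]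
  · intro w _ hw
    simp [mapOp, hw]
  · simp

def swapGate : Op2 := (1 : Op2).submatrix id Prod.swap

lemma swapGate_mem : swapGate ∈ Matrix.unitaryGroup (Fin 2 × Fin 2) ℂ := by
  rw [Matrix.mem_unitaryGroup_iff]
  ext ⟨p, q⟩ ⟨r, s⟩
  fin_cases p <;> fin_cases q <;> fin_cases r <;> fin_cases s <;>
    simp [swapGate, Matrix.mul_apply, Fintype.sum_prod_type, Matrix.star_apply, Matrix.one_apply]

lemma onPair_swapGate {n : ℕ} {i j : Fin n} (h : i ≠ j) :
    onPair i j swapGate = mapOp fun x => x ∘ Equiv.swap i j := by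
  ext y x
  rw [onPair, swapGate, Matrix.submatrix_apply, Matrix.one_apply, ← ite_and, mapOp]
  refine if_congr ?_ rfl rfl
  rw [id, Prod.swap_prod_mk, Prod.mk.injEq, funext_iff]
  constructor
  · rintro ⟨h1, h2, h3⟩ k
    by_cases hi : k = i
    · subst hi; simpa using h2
    by_cases hj : k = j
    · subst hj; simpa using h3
    · simpa [Equiv.swap_apply_of_ne_of_ne hi hj] using h1 k hi hj
  · intro hk
    refine ⟨fun k hi hj => ?_, by simpa using hk i, by simpa using hk j⟩
    simpa [Equiv.swap_apply_of_ne_of_ne hi hj] using hk k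

lemma onPair_comp_perm {n : ℕ} (π : Equiv.Perm (Fin n)) (i j : Fin n) (G : Op2) (y x : Bits n) :
    onPair i j G (y ∘ π) (x ∘ π) = onPair (π i) (π j) G y x := by
  simp only [onPair, Function.comp_apply]
  refine if_congr ⟨fun h k hi hj => ?_, fun h k hi hj => ?_⟩ rfl rfl
  · have := h (π.symm k) (fun hk => hi (by simp [← hk])) (fun hk => hj (by simp [← hk]))
    simpa using this
  · exact h (π k) (fun hk => hi (π.injective hk)) (fun hk => hj (π.injective hk))

lemma swapGate_conj {n : ℕ} {i j j' : Fin n} (hij : i ≠ j) (hij' : i ≠ j') (hjj' : j ≠ j')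
    (G : Op2) : onPair j j' swapGate * onPair i j G * onPair j j' swapGate = onPair i j' G := by
  rw [onPair_swapGate hjj', mapOp_conj]
  · funext y x
    rw [onPair_comp_perm, Equiv.swap_apply_of_ne_of_ne hij hij', Equiv.swap_apply_left]
  · intro x
    funext k
    simp

/-- Induction on the distance: conjugating by a SWAP of the last two qubits shortens it by one, at
the price of two more two-qubit unitaries on neighbours. -/
lemma cost_onPair {S : Set Op2} {k : ℕ}
    (hk : ∀ G ∈ Matrix.unitaryGroup (Fin 2 × Fin 2) ℂ, PairCost S k G) {n : ℕ} {G : Op2}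
    (hG : G ∈ Matrix.unitaryGroup (Fin 2 × Fin 2) ℂ) (i d : ℕ) (hd : i + d + 1 < n) :
    Cost S n (k * (2 * d + 1)) (onPair ⟨i, by omega⟩ ⟨i + d + 1, hd⟩ G) := by
  induction d with
  | zero => simpa using hk G hG n i hd
  | succ d ih =>
    have hs := hk swapGate swapGate_mem n (i + d + 1) hd
    have h := (hs.mul (ih (by omega))).mul hs
    rw [swapGate_conj (by simp [Fin.ext_iff]; omega) (by simp [Fin.ext_iff]; omega)
      (by simp [Fin.ext_iff])] at h
    refine h.mono (le_of_eq ?_)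
    ring

theorem universal_of_cost {S : Set Op2} (hS : LocalCost S) {c : ℕ} (hc : PairCost S c cnot) :
    Universal S := by
  obtain ⟨k, hk⟩ := pairCost_unitary hS hc
  have hpair {n : ℕ} {i j : Fin n} (hij : i < j) {G : Op2}
      (hG : G ∈ Matrix.unitaryGroup (Fin 2 × Fin 2) ℂ) :
      Cost S n ((1 + 2 * k) * n) (onPair i j G) := by
    obtain ⟨d, hd⟩ := Nat.exists_eq_add_of_lt hij
    have h := cost_onPair hk (n := n) hG i d (by omega)
    have hj : (⟨i + d + 1, by omega⟩ : Fin n) = j := Fin.ext hd.symm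
    rw [hj] at h
    refine h.mono ?_
    have : 2 * d + 1 ≤ 2 * n := by omega
    nlinarith
  have helem {n : ℕ} (M : Op n) (hM : M ∈ elementaryGates n) :
      Cost S n ((1 + 2 * k) * n) M := by
    rcases hM with ⟨i, A, hA, rfl⟩ | ⟨i, j, hij, G, hG, rfl⟩
    · refine (hS n i A hA).mono ?_
      have := i.pos
      nlinarith
    · rcases lt_or_gt_of_ne hij with h | h
      · exact hpair h hG
      · rw [onPair_swap]
        exact hpair h (submatrix_equiv_mem (Equiv.prodComm _ _) hG)
  have hcirc {n : ℕ} (K : List (Op n)) (hK : IsCircuit (elementaryGates n) K) :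
      Cost S n ((1 + 2 * k) * n * K.length) K.prod :=
    Cost.list_prod fun M hM => helem M (hK M hM)
  refine ⟨fun n U hU => ?_, 1 + 2 * k, fun n K hK => hcirc K hK⟩
  -- With no qubits there are no gates, but every unitary is then a phase, and the empty circuit
  -- implements it.
  rcases Nat.eq_zero_or_pos n with rfl | hn
  · obtain ⟨u, rfl⟩ : ∃ u : ℂ, U = u • 1 := by
      refine ⟨U 0 0, ?_⟩
      ext y x
      rw [Subsingleton.elim y 0, Subsingleton.elim x 0]
      simp
    have hu : ‖u‖ = 1 := by
      have h := congrFun (congrFun (Matrix.mem_unitaryGroup_iff'.1 hU) 0) 0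
      rw [star_smul, star_one, Matrix.smul_mul, Matrix.one_mul, smul_smul, Matrix.smul_apply,
        Complex.star_def, Complex.conj_mul', Matrix.one_apply_eq, smul_eq_mul, mul_one] at h
      have h' : ‖u‖ ^ 2 = 1 := by exact_mod_cast h
      nlinarith [norm_nonneg u]
    have hu0 : u ≠ 0 := norm_ne_zero_iff.1 (by rw [hu]; exact one_ne_zero)
    refine ⟨[], by simp [IsCircuit], u⁻¹, by rw [norm_inv, hu, inv_one], ?_⟩
    rw [List.prod_nil, Matrix.one_mul, Matrix.mul_smul, smul_smul, inv_mul_cancel₀ hu0, one_smul,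
      Matrix.mul_one]
  · obtain ⟨l, hl⟩ := exists_basic_unitary hn
    obtain ⟨K, hK, rfl, -⟩ := hl U hU
    obtain ⟨L, hL, hi, -⟩ := hcirc K fun M hM => basicGates_subset_elementaryGates n (hK M hM)
    exact ⟨L, hL, hi⟩

lemma Universal.mono {S T : Set Op2} (hST : S ⊆ T) (hS : Universal S) : Universal T := by
  have hmono {m : ℕ} {L : List (Op m)} (hL : IsCircuit (nearestNeighbourGates S m) L) :
      IsCircuit (nearestNeighbourGates T m) L := by
    intro M hM
    obtain ⟨k, hk, G, hG, rfl⟩ := hL M hM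
    exact ⟨k, hk, G, hST hG, rfl⟩
  obtain ⟨h1, C, h2⟩ := hS
  refine ⟨fun n U hU => ?_, C, fun n K hK => ?_⟩
  · obtain ⟨L, hL, hi⟩ := h1 n U hU
    exact ⟨L, hmono hL, hi⟩
  · obtain ⟨L, hL, hi⟩ := h2 n K hK
    exact ⟨L, hmono hL, hi⟩

/-! ### Products of conjugates of a rotation -/

/-- The monoid generated by the conjugates of `R_z(α)` in `U(2)`. -/
def conjMonoid (α : ℝ) : Submonoid Op1 :=
  Submonoid.closure {M | ∃ V ∈ Matrix.unitaryGroup (Fin 2) ℂ, M = V * rotZ α * star V}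

lemma conj_mem_conjMonoid {α : ℝ} {V : Op1} (hV : V ∈ Matrix.unitaryGroup (Fin 2) ℂ) :
    V * rotZ α * star V ∈ conjMonoid α :=
  Submonoid.subset_closure ⟨V, hV, rfl⟩

lemma conjMonoid_conj {α : ℝ} {M V : Op1} (hM : M ∈ conjMonoid α)
    (hV : V ∈ Matrix.unitaryGroup (Fin 2) ℂ) : V * M * star V ∈ conjMonoid α := by
  induction hM using Submonoid.closure_induction with
  | mem M hM =>
    obtain ⟨W, hW, rfl⟩ := hM
    have := conj_mem_conjMonoid (α := α) (mul_mem hV hW)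
    rw [star_mul] at this
    simpa only [mul_assoc] using this
  | one =>
    rw [mul_one, Matrix.mem_unitaryGroup_iff.1 hV]
    exact one_mem _
  | mul M N _ _ hM hN =>
    have h : V * (M * N) * star V = V * M * star V * (V * N * star V) := by
      have h1 : V * M * star V * (V * N * star V) = V * M * (star V * V) * N * star V := by
        simp only [mul_assoc]
      rw [h1, Matrix.mem_unitaryGroup_iff'.1 hV, mul_one]
      simp only [mul_assoc]
    rw [h]
    exact mul_mem hM hN

/-- An element of `SU(2)` with trace `2 cos θ` is conjugate to `R_z(θ)`. -/
lemma exists_conj_rotZ {Q : Op1} (hQ : Q ∈ Matrix.unitaryGroup (Fin 2) ℂ) (hdet : Q.det = 1)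
    {θ : ℝ} (htr : Q.trace = 2 * Complex.cos θ) :
    ∃ V ∈ Matrix.unitaryGroup (Fin 2) ℂ, V * Q * star V = rotZ θ := by
  have hadj : Q.adjugate = star Q := by
    have h1 : star Q * Q = 1 := Matrix.mem_unitaryGroup_iff'.1 hQ
    rw [← one_mul Q.adjugate, ← h1, mul_assoc, Matrix.mul_adjugate, hdet, one_smul, mul_one]
  have hs : Q 1 1 = star (Q 0 0) := by
    simpa [Matrix.adjugate_fin_two, Matrix.star_apply] using congrFun (congrFun hadj 0) 0
  have hq : Q 0 1 = -star (Q 1 0) := by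
    have := congrFun (congrFun hadj 0) 1
    rw [Matrix.adjugate_fin_two] at this
    simp only [Matrix.star_apply, Matrix.of_apply, Matrix.cons_val', Matrix.cons_val_zero,
      Matrix.cons_val_one, Matrix.cons_val_fin_one] at this
    rw [← this, neg_neg]
  set e : ℂ := Complex.exp (θ * Complex.I) with he
  have hee : star e = Complex.exp (-(θ * Complex.I)) := by
    rw [he, Complex.star_def, ← Complex.exp_conj]
    simp
  have hee1 : e * star e = 1 := by
    rw [hee, he, ← Complex.exp_add, add_neg_cancel, Complex.exp_zero]
  have hsum : e + star e = 2 * Complex.cos θ := by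
    rw [hee, he, Complex.two_cos, neg_mul]
  -- The characteristic polynomial is x² - (e + ē)x + eē, so e is an eigenvalue.
  have hev : (Q - e • (1 : Op1)).det = 0 := by
    rw [Matrix.det_fin_two] at hdet ⊢
    rw [Matrix.trace_fin_two] at htr
    simp only [Matrix.sub_apply, Matrix.smul_apply, smul_eq_mul, Matrix.one_apply_eq, mul_one,
      ne_eq, zero_ne_one, one_ne_zero, not_false_eq_true, Matrix.one_apply_ne, mul_zero, sub_zero]
    linear_combination hdet - e * htr + e * hsum - hee1
  obtain ⟨v, hv0, hv⟩ := Matrix.exists_mulVec_eq_zero_iff.2 hev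
  have hv' : Q.mulVec v = e • v := by
    rw [Matrix.sub_mulVec, Matrix.smul_mulVec, Matrix.one_mulVec, sub_eq_zero] at hv
    exact hv
  have h0 : Q 0 0 * v 0 - star (Q 1 0) * v 1 = e * v 0 := by
    have := congrFun hv' 0
    simp only [Matrix.mulVec, dotProduct, Fin.sum_univ_two, Pi.smul_apply, smul_eq_mul, hq] at this
    linear_combination this
  have h1 : Q 1 0 * v 0 + star (Q 0 0) * v 1 = e * v 1 := by
    have := congrFun hv' 1
    simp only [Matrix.mulVec, dotProduct, Fin.sum_univ_two, Pi.smul_apply, smul_eq_mul, hs] at this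
    linear_combination this
  have h0' := congrArg star h0
  have h1' := congrArg star h1
  simp only [star_sub, star_add, star_mul', star_star] at h0' h1'
  set s : ℝ := ‖v 0‖ ^ 2 + ‖v 1‖ ^ 2 with hsdef
  have hspos : 0 < s := by
    by_contra hneg
    have e0 : ‖v 0‖ = 0 := by
      apply pow_eq_zero_iff (two_ne_zero) |>.1
      nlinarith [sq_nonneg ‖v 0‖, sq_nonneg ‖v 1‖]
    have e1 : ‖v 1‖ = 0 := by
      apply pow_eq_zero_iff (two_ne_zero) |>.1
      nlinarith [sq_nonneg ‖v 0‖, sq_nonneg ‖v 1‖]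
    apply hv0
    funext i
    fin_cases i
    · exact norm_eq_zero.1 e0
    · exact norm_eq_zero.1 e1
  have hsv : star (v 0) * v 0 + star (v 1) * v 1 = s := by
    rw [Complex.star_def, Complex.conj_mul', Complex.conj_mul', hsdef]
    push_cast
    rfl
  -- In SU(2) the vector (-v̄₁, v̄₀) orthogonal to v is an eigenvector for the conjugate eigenvalue,
  -- so P diagonalizes Q and only needs normalizing.
  set P : Op1 := !![v 0, -star (v 1); v 1, star (v 0)] with hP
  have hPs : star P * P = (s : ℂ) • 1 := by
    ext i j
    fin_cases i <;> fin_cases j <;>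
      simp [hP, Matrix.mul_apply, Fin.sum_univ_two, Matrix.star_apply, ← hsv] <;> ring
  have hQP : Q * P = P * rotZ θ := by
    rw [rotZ, ← he, ← hee, Matrix.eta_fin_two Q, hs, hq, hP, Matrix.mul_fin_two,
      Matrix.mul_fin_two]
    congr 1
    ext i j
    fin_cases i <;> fin_cases j <;> simp only [Fin.zero_eta, Fin.mk_one, Matrix.cons_val_zero,
      Matrix.cons_val_one, Matrix.cons_val_fin_one]
    · linear_combination h0
    · linear_combination -h1'
    · linear_combination h1
    · linear_combination h0'
  set t : ℂ := ((√s : ℝ) : ℂ)⁻¹ with ht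
  have hts : t * t * s = 1 := by
    rw [ht, ← mul_inv, ← Complex.ofReal_mul, Real.mul_self_sqrt hspos.le, inv_mul_cancel₀]
    exact_mod_cast hspos.ne'
  have htt : star t = t := by
    rw [ht, star_inv₀, Complex.star_def, Complex.conj_ofReal]
  have hPu : star (t • P) * (t • P) = 1 := by
    rw [star_smul, htt, Matrix.smul_mul, Matrix.mul_smul, hPs, smul_smul, smul_smul, hts, one_smul]
  have hPmem : t • P ∈ Matrix.unitaryGroup (Fin 2) ℂ := Matrix.mem_unitaryGroup_iff'.2 hPu
  refine ⟨star (t • P), Unitary.star_mem hPmem, ?_⟩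
  rw [star_star, mul_assoc, Matrix.mul_smul, hQP, ← Matrix.smul_mul, ← mul_assoc, hPu, one_mul]

lemma pauliX_conj_rotZ (α : ℝ) : pauliX * rotZ α * pauliX = rotZ (-α) := by
  ext i j
  fin_cases i <;> fin_cases j <;> simp [pauliX, rotZ]

/-- R_z(-α) is a conjugate of R_z(α) by X. Its product with the conjugate by e^{iφX} has half-trace
1 - 2 sin²α sin²φ, which sweeps [1 - 2 sin²α, 1] as φ varies. In SU(2) the trace determines the
conjugacy class. -/
lemma rotZ_mem_conjMonoid {α θ : ℝ} (hα : Real.sin α ≠ 0)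
    (hθ : 1 - Real.cos θ ≤ 2 * Real.sin α ^ 2) : rotZ θ ∈ conjMonoid α := by
  have hs2 : 0 < Real.sin α ^ 2 := by positivity
  set r : ℝ := (1 - Real.cos θ) / (2 * Real.sin α ^ 2) with hr
  have hr0 : 0 ≤ r := div_nonneg (by linarith [Real.cos_le_one θ]) (by linarith)
  have hr1 : r ≤ 1 := (div_le_one (by linarith)).2 hθ
  set φ : ℝ := Real.arcsin (√r) with hφ
  have hsin : Real.sin φ ^ 2 = r := by
    rw [hφ, Real.sin_arcsin (by linarith [Real.sqrt_nonneg r]) (Real.sqrt_le_one.2 hr1),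
      Real.sq_sqrt hr0]
  have hkey : Real.sin φ ^ 2 * (2 * Real.sin α ^ 2) = 1 - Real.cos θ := by
    rw [hsin, hr, div_mul_cancel₀]
    linarith
  have hkey' : Complex.sin φ ^ 2 * (2 * Complex.sin α ^ 2) = 1 - Complex.cos θ := by
    exact_mod_cast congrArg Complex.ofReal hkey
  have hstar : star (rotX φ) = rotX (-φ) := by
    rw [rotX_eq, rotX_eq, star_mul, star_mul, star_hadamard, star_rotZ, mul_assoc]
  set Q : Op1 := rotZ (-α) * (rotX φ * rotZ α * star (rotX φ)) with hQdef
  have hQ : Q ∈ conjMonoid α := by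
    refine mul_mem ?_ (conj_mem_conjMonoid (rotX_mem φ))
    have := conj_mem_conjMonoid (α := α) pauliX_mem
    rwa [star_pauliX, pauliX_conj_rotZ] at this
  have hQu : Q ∈ Matrix.unitaryGroup (Fin 2) ℂ :=
    mul_mem (rotZ_mem _) (mul_mem (mul_mem (rotX_mem _) (rotZ_mem _))
      (Unitary.star_mem (rotX_mem _)))
  have hdet : Q.det = 1 := by
    rw [hQdef, hstar]
    simp only [Matrix.det_mul, det_rotZ, det_rotX, mul_one]
  have htr : Q.trace = 2 * Complex.cos θ := by
    have e1 : Complex.exp (α * Complex.I) = Complex.cos α + Complex.sin α * Complex.I :=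
      Complex.exp_mul_I _
    have e2 : Complex.exp (-(α * Complex.I)) = Complex.cos α - Complex.sin α * Complex.I := by
      rw [← neg_mul, Complex.exp_mul_I, Complex.cos_neg, Complex.sin_neg]
      ring
    have h1 := Complex.sin_sq_add_cos_sq (α : ℂ)
    have h2 := Complex.sin_sq_add_cos_sq (φ : ℂ)
    rw [hQdef, hstar, Matrix.trace_fin_two]
    simp only [rotX, rotZ, Matrix.mul_fin_two, Matrix.of_apply, Matrix.cons_val',
      Matrix.cons_val_zero, Matrix.cons_val_one, Matrix.cons_val_fin_one, Complex.ofReal_neg, Complex.cos_neg,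
      Complex.sin_neg, neg_mul, neg_neg, e1, e2]
    ring_nf
    simp only [Complex.I_sq, show Complex.I ^ 4 = 1 from Complex.I_pow_four]
    ring_nf
    linear_combination (-2) * hkey' + 2 * h2 + 2 * Complex.cos φ ^ 2 * h1 +
      2 * Complex.sin φ ^ 2 * h1
  obtain ⟨V, hV, hVQ⟩ := exists_conj_rotZ hQu hdet htr
  rw [← hVQ]
  exact conjMonoid_conj hQ hV

/-- R_z(π/2) is a power of an R_z(θ) with θ small enough to be reached, and a Hadamard turns it into
e^{iπX/2} = iX. The factor i is unavoidable, since the monoid lies in SU(2). The bound θ ≤ 2|sin α|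
suffices because 1 - cos θ ≤ θ²/2. -/
lemma I_smul_pauliX_mem_conjMonoid {α : ℝ} (hα : Real.sin α ≠ 0) :
    Complex.I • pauliX ∈ conjMonoid α := by
  obtain ⟨N, hN⟩ := exists_nat_ge (Real.pi / (4 * |Real.sin α|))
  have hpos : 0 < |Real.sin α| := abs_pos.2 hα
  set θ : ℝ := Real.pi / 2 / (N + 1 : ℕ) with hθ
  have hN1 : (0 : ℝ) < (N + 1 : ℕ) := by positivity
  have hθ0 : 0 ≤ θ := by positivity
  have hθ2 : θ ≤ 2 * |Real.sin α| := by
    rw [hθ, div_le_iff₀ hN1]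
    rw [div_le_iff₀ (by positivity)] at hN
    push_cast
    nlinarith
  have hcos : 1 - Real.cos θ ≤ 2 * Real.sin α ^ 2 := by
    have h1 := Real.one_sub_sq_div_two_le_cos (x := θ)
    have h2 : θ ^ 2 ≤ (2 * |Real.sin α|) ^ 2 := pow_le_pow_left₀ hθ0 hθ2 2
    rw [mul_pow, sq_abs] at h2
    linarith
  have hpow (k : ℕ) : rotZ (k * θ) ∈ conjMonoid α := by
    induction k with
    | zero => simp [rotZ_zero]
    | succ k ih =>
      rw [Nat.cast_succ, add_mul, one_mul, rotZ_add]
      exact mul_mem ih (rotZ_mem_conjMonoid hα hcos)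
  have h := conjMonoid_conj (hpow (N + 1)) hadamard_mem
  rw [star_hadamard, ← rotX_eq, hθ, mul_div_cancel₀ _ hN1.ne'] at h
  convert h using 1
  ext i j
  fin_cases i <;> fin_cases j <;> simp [rotX, pauliX]

/-! ### Universality of the construction set -/

/-- The two-qubit operator `e^{icZ⊗Z}`. -/
def zzGate (c : ℝ) : Op2 := ctrl (rotZ c) (rotZ (-c))

lemma zzGate_eq_diagonal (c : ℝ) : zzGate c = Matrix.diagonal fun p =>
    if p.1 = p.2 then Complex.exp (c * Complex.I) else Complex.exp (-(c * Complex.I)) := by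
  ext ⟨p, q⟩ ⟨r, s⟩
  fin_cases p <;> fin_cases q <;> fin_cases r <;> fin_cases s <;> simp [zzGate, ctrl, rotZ]

lemma zzGate_eq_ppGate (c : ℝ) : zzGate c =
    ppGate (Complex.exp (c * Complex.I) • 1) (Complex.exp (-(c * Complex.I)) • 1) := by
  ext ⟨p, q⟩ ⟨r, s⟩
  fin_cases p <;> fin_cases q <;> fin_cases r <;> fin_cases s <;>
    simp [zzGate, ctrl, rotZ, ppGate]

lemma implements_diagonal {n : ℕ} {D : Bits (2 * n) → ℂ} {d : Bits n → ℂ}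
    (h : ∀ x, D (enc x) = d x) :
    Matrix.diagonal D * encode n = encode n * Matrix.diagonal d := by
  ext y x
  rw [Matrix.diagonal_mul, Matrix.mul_diagonal, encode_apply]
  split_ifs with hy
  · rw [hy, h, mul_one, one_mul]
  · simp

lemma nearest_neighbour_list_prod {S : Set Op2} {m k : ℕ} (hk : k + 1 < m) {L : List Op2}
    (hL : ∀ G ∈ L, G ∈ S) : ∃ L' : List (Op m), IsCircuit (nearestNeighbourGates S m) L' ∧
      L'.prod = onPair (⟨k, Nat.lt_of_succ_lt hk⟩ : Fin m) ⟨k + 1, hk⟩ L.prod ∧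
      L'.length = L.length := by
  induction L with
  | nil => exact ⟨[], by simp [IsCircuit], by simp [onPair_one], rfl⟩
  | cons G L ih =>
    obtain ⟨L', h1, h2, h3⟩ := ih fun G hG => hL G (List.mem_cons_of_mem _ hG)
    refine ⟨onPair (⟨k, Nat.lt_of_succ_lt hk⟩ : Fin m) ⟨k + 1, hk⟩ G :: L',
      fun M hM => ?_, ?_, by simp [h3]⟩
    · rcases List.mem_cons.1 hM with rfl | hM
      · exact ⟨k, hk, G, hL G List.mem_cons_self, rfl⟩
      · exact h1 M hM
    · rw [List.prod_cons, List.prod_cons, h2, ← onPair_mul (mk_ne_mk_succ hk)]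

/-- `G(A,B)` acts on the code space of one logical qubit as `A`. -/
lemma onPair_ppGate_mul_encode {n : ℕ} (i : Fin n) (A B : Op1) :
    onPair (⟨2 * i, by omega⟩ : Fin (2 * n)) ⟨2 * i + 1, by omega⟩ (ppGate A B) * encode n =
      encode n * onQubit i A := by
  ext y x
  rw [mul_encode_apply, onPair, enc_even, enc_odd]
  by_cases hy : ∃ w, y = enc w
  · obtain ⟨w, rfl⟩ := hy
    rw [encode_mul_enc, enc_even, enc_odd, onQubit]
    simp only [ppGate, if_true]
    refine if_congr ⟨fun h k hk => ?_, fun h k h1 h2 => ?_⟩ rfl rfl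
    · have hk' : (k : ℕ) ≠ i := fun h => hk (Fin.ext h)
      rw [← enc_even w k, ← enc_even x k]
      apply h <;> rw [ne_eq, Fin.ext_iff] <;> simp only <;> omega
    · apply h
      intro hk
      have hk' : (k : ℕ) / 2 = i := congrArg Fin.val hk
      rw [ne_eq, Fin.ext_iff] at h1 h2
      simp only at h1 h2
      omega
  · push Not at hy
    rw [encode_mul_of_forall_ne _ hy]
    split_ifs with h
    · simp only [ppGate, if_true]
      split_ifs with h'
      · exfalso
        refine hy (fun j => y ⟨2 * j, by omega⟩) (eq_enc_iff.2 fun j => ⟨rfl, ?_⟩)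
        by_cases hj : j = i
        · rw [hj, h']
        · have hj' : (j : ℕ) ≠ i := fun h => hj (Fin.ext h)
          rw [h, h, enc_even, enc_odd] <;> rw [ne_eq, Fin.ext_iff] <;> simp only <;> omega
      · rfl
    · rfl

lemma localCost_constructionSet (g : Op2) : LocalCost (constructionSet g) := by
  intro n i A hA
  refine ⟨[onPair ⟨2 * i, by omega⟩ ⟨2 * i + 1, by omega⟩ (ppGate A A)], ?_,
    ⟨1, norm_one, ?_⟩, le_rfl⟩
  · intro M hM
    rw [List.mem_singleton] at hM
    exact ⟨2 * i, by omega, ppGate A A, Or.inl (Or.inl ⟨A, hA, rfl⟩), hM⟩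
  · rw [List.prod_singleton, one_smul, onPair_ppGate_mul_encode]

lemma ppGate_rotZ_mem_constructionSet (g : Op2) (χ χ' : ℝ) :
    ppGate (rotZ χ) (rotZ χ') ∈ constructionSet g := by
  refine Or.inl (Or.inr ⟨(χ + χ') / 2, (χ - χ') / 2, ?_⟩)
  rw [rotZ_kronecker]
  congr 2 <;> ring

/-- As b = 0, one gate G(e^{-iaX}, e^{-iaX}) undoes the X-rotation in both blocks at once; only the
relative phase e^{±ic} survives. Individual gates of this circuit may leave the code space, but
their product is diagonal. -/
lemma pairCost_zzGate {g : Op2} {a c : ℝ} (hg : HasParams g a 0 c) :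
    PairCost (constructionSet g) 4 (zzGate c) := by
  intro n k hk
  obtain ⟨δ, χ, χ', ξ, ξ', h⟩ := hasParams_eq_ppGate hg
  set L : List Op2 := [ppGate (rotX (-a)) (rotX (-a)), ppGate (rotZ (-χ)) (rotZ (-χ')), g,
    ppGate (rotZ (-ξ)) (rotZ (-ξ'))] with hL
  have hLS : ∀ G ∈ L, G ∈ constructionSet g := by
    intro G hG
    simp only [hL, List.mem_cons, List.not_mem_nil, or_false] at hG
    rcases hG with rfl | rfl | rfl | rfl
    · exact Or.inl (Or.inl ⟨_, rotX_mem _, rfl⟩)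
    · exact ppGate_rotZ_mem_constructionSet g _ _
    · exact Or.inr rfl
    · exact ppGate_rotZ_mem_constructionSet g _ _
  have hblock (z : ℂ) (χ ξ : ℝ) : rotX (-a) * (rotZ (-χ) *
      (z • (rotZ χ * rotX a * rotZ ξ) * rotZ (-ξ))) = z • 1 := by
    have h1 : rotX (-a) * (rotZ (-χ) * ((rotZ χ * rotX a * rotZ ξ) * rotZ (-ξ))) =
        rotX (-a) * ((rotZ (-χ) * rotZ χ) * rotX a * (rotZ ξ * rotZ (-ξ))) := by
      simp only [mul_assoc]
    rw [Matrix.smul_mul, Matrix.mul_smul, Matrix.mul_smul, h1, ← rotZ_add, ← rotZ_add,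
      neg_add_cancel, add_neg_cancel, rotZ_zero, one_mul, mul_one, ← rotX_add, neg_add_cancel,
      rotX_zero]
  have hprod : L.prod = Complex.exp (δ * Complex.I) • zzGate c := by
    simp only [hL, List.prod_cons, List.prod_nil, mul_one]
    rw [h, sub_zero, add_zero, ppGate_mul, ppGate_mul, ppGate_mul, hblock, hblock,
      zzGate_eq_ppGate, ← ppGate_smul, smul_smul, smul_smul, ← Complex.exp_add, ← Complex.exp_add]
    congr 3 <;> push_cast <;> ring_nf
  -- The gates act on physical qubits 2k+1 and 2k+2: the last one of logical qubit k and the first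
  -- one of k+1.
  obtain ⟨L', h1, h2, h3⟩ :=
    nearest_neighbour_list_prod (m := 2 * n) (k := 2 * k + 1) (by omega) hLS
  refine ⟨L', h1, ⟨Complex.exp (δ * Complex.I), Complex.norm_exp_ofReal_mul_I δ, ?_⟩, h3.le⟩
  rw [h2, hprod, onPair_smul, Matrix.smul_mul, zzGate_eq_diagonal, onPair_diagonal,
    onPair_diagonal]
  congr 1
  refine implements_diagonal fun x => ?_
  have e1 := enc_odd x ⟨k, by omega⟩
  have e2 := enc_even x ⟨k + 1, hk⟩
  simp only [mul_add, mul_one] at e1 e2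
  simp only [e1, e2]

lemma one_kronecker_eq_ctrl (V : Op1) : (1 : Op1) ⊗ₖ V = ctrl V V := by
  ext ⟨p, q⟩ ⟨r, s⟩
  fin_cases p <;> fin_cases r <;> simp [ctrl]

/-- Between V and R_z(c)V* on the target, e^{icZ⊗Z} acts as V R_z(2c) V* when the control is 0 and
trivially when it is 1. Products of these give every controlled M with M in `conjMonoid (c + c)`, in
particular iX. -/
lemma pairCost_cnot {S : Set Op2} (hS : LocalCost S) {k : ℕ} {c : ℝ}
    (hc : PairCost S k (zzGate c)) (hsin : Real.sin (c + c) ≠ 0) :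
    ∃ l, PairCost S l cnot := by
  have hmon (M : Op1) (hM : M ∈ conjMonoid (c + c)) : ∃ l, PairCost S l (ctrl M 1) := by
    induction hM using Submonoid.closure_induction with
    | mem M hM =>
      obtain ⟨V, hV, rfl⟩ := hM
      refine ⟨1 + k + 1, ?_⟩
      have h := ((hS.right hV).mul hc).mul
        (hS.right (mul_mem (rotZ_mem c) (Unitary.star_mem hV)))
      rw [one_kronecker_eq_ctrl, one_kronecker_eq_ctrl, zzGate, ctrl_mul, ctrl_mul] at h
      have e1 : V * rotZ c * (rotZ c * star V) = V * rotZ (c + c) * star V := by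
        rw [rotZ_add]
        simp only [mul_assoc]
      have e2 : V * rotZ (-c) * (rotZ c * star V) = 1 := by
        rw [mul_assoc, ← mul_assoc (rotZ (-c)), ← rotZ_add, neg_add_cancel, rotZ_zero, one_mul,
          Matrix.mem_unitaryGroup_iff.1 hV]
      rwa [e1, e2] at h
    | one =>
      rw [ctrl_one_one]
      exact ⟨0, PairCost.one⟩
    | mul M N _ _ hM hN =>
      obtain ⟨l, hl⟩ := hM
      obtain ⟨m, hm⟩ := hN
      refine ⟨l + m, ?_⟩
      have := hl.mul hm
      rwa [ctrl_mul, mul_one] at this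
  obtain ⟨l, hl⟩ := hmon _ (I_smul_pauliX_mem_conjMonoid hsin)
  have hD : (Matrix.diagonal fun p : Fin 2 =>
      Complex.exp ((if p = 0 then -(Real.pi / 2) else 0 : ℝ) * Complex.I)) ∈
      Matrix.unitaryGroup (Fin 2) ℂ := diagonal_exp_mem fun p => if p = 0 then -(Real.pi / 2) else 0
  -- The phase diag(-i, 1) on the control cancels the i of iX, and the two X's move the control
  -- condition from 0 to 1.
  have h := (((hS.left pauliX_mem).mul (hS.left hD)).mul hl).mul (hS.left pauliX_mem)
  refine ⟨1 + 1 + l + 1, ?_⟩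
  convert h using 1
  have hI : Complex.exp (-(Real.pi / 2 * Complex.I)) = -Complex.I := by
    rw [Complex.exp_neg, Complex.exp_pi_div_two_mul_I, Complex.inv_I]
  have hDX : (Matrix.diagonal fun p : Fin 2 =>
      Complex.exp ((if p = 0 then -(Real.pi / 2) else 0 : ℝ) * Complex.I)) =
      Matrix.diagonal ![-Complex.I, 1] := by
    congr 1
    funext p
    fin_cases p <;> simp [hI]
  rw [hDX]
  ext ⟨p, q⟩ ⟨r, s⟩
  fin_cases p <;> fin_cases q <;> fin_cases r <;> fin_cases s <;>
    simp [Matrix.mul_apply, Fintype.sum_prod_type, Fin.sum_univ_two, cnot, ctrl, pauliX,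
      Matrix.one_apply, Matrix.diagonal_apply]

theorem universal_constructionSet {g : Op2} {a c : ℝ} (hg : HasParams g a 0 c)
    (hc : ∀ k : ℤ, c ≠ k * (Real.pi / 2)) : Universal (constructionSet g) := by
  -- The excluded values of c are those for which R_z(2c) = ±1, so that its conjugates generate
  -- nothing new.
  have hsin : Real.sin (c + c) ≠ 0 := by
    rw [ne_eq, Real.sin_eq_zero_iff]
    rintro ⟨k, hk⟩
    exact hc k (by linarith)
  obtain ⟨l, hl⟩ := pairCost_cnot (localCost_constructionSet g) (pairCost_zzGate hg) hsin
  exact universal_of_cost (localCost_constructionSet g) hl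

theorem universal_Mb : Universal Mb := by
  -- Any admissible gate will do; c = 1 lies strictly between 0 and π/2.
  have hg : HasParams (nonlocalCore 0 0 1) 0 0 1 := ⟨0, 0, 0, 0, 0, by simp [rotZ_zero]⟩
  refine (universal_constructionSet hg fun k hk => ?_).mono (constructionSet_subset_Mb hg)
  have h3 := Real.pi_gt_three
  rcases le_or_gt k 0 with h | h
  · have : (k : ℝ) ≤ 0 := by exact_mod_cast h
    nlinarith
  · have : (1 : ℝ) ≤ k := by exact_mod_cast h
    nlinarith

end

end PPGates

theorem mainTheorem3 :
    PPGates.Universal PPGates.Mb ∧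
    PPGates.Universal PPGates.Ma ∧
    PPGates.Ma = PPGates.Mb ∧
    (∀ (g : PPGates.Op2) (a c : ℝ), PPGates.HasParams g a 0 c →
      (∀ k : ℤ, c ≠ k * (Real.pi / 2)) →
      PPGates.constructionSet g ⊆ PPGates.Mb ∧
      PPGates.Universal (PPGates.constructionSet g)) ∧
    ¬ PPGates.ApproxUniversal PPGates.Mc := by
  refine ⟨PPGates.universal_Mb, ?_, PPGates.Ma_eq_Mb, fun g a c hg hc => ?_,
    PPGates.not_approxUniversal_Mc⟩
  · rw [PPGates.Ma_eq_Mb]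
    exact PPGates.universal_Mb
  · exact ⟨PPGates.constructionSet_subset_Mb hg, PPGates.universal_constructionSet hg hc⟩
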